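/- Let $\mathbf k$ be an algebraically closed field of characteristic $0$. For $q\in\mathbf k$ let $N(q)$ be the order of $q$ if $q\ne 1$ is a root of unity, and $N(q)=\infty$ otherwise. Let $(V,c)$ be a $2$-dimensional braided vector space (that is, $c\in\operatorname{GL}(V\otimes V)$ satisfies the braid equation) of finite group type: $V$ has a basis $(y_i)$ and there are $g_i\in\operatorname{GL}(V)$ generating a finite group with $c(y_i\otimes y_j)=g_i(y_j)\otimes y_i$. Let $x_1,x_2$ be a basis of $V$ and $(q_{ij})$ a matrix such that $c(x_i\otimes x_j)=q_{ij}\,x_j\otimes x_i$ for $i,j\in\{1,2\}$. Let $\mathfrak B(V)$ be the Nichols algebra of $(V,c)$, i.e. the image of the map from the tensor algebra of $V$ to the tensor coalgebra of $V$ given in degree $n$ by the quantum symmetrizer $\sum_{x\in\mathbb S_n}s(x)$, where $s(x)$ is the action on $V^{\otimes n}$ of the lift of $x$ to the braid group through reduced expressions. For $x\in V$ let $\operatorname{Ad}_x(y)=xy-m(c(x\otimes y))$ be the braided adjoint action on $\mathfrak B(V)$, with $m$ the multiplication. The nilpotency order of an endomorphism $T$ on a vector $v$ is $d=s+1$ if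 $T^{s}v\neq 0$ and $T^{s+1}v=0$. Put $N_j=N(q_{jj})$ for $j=1,2$. Let $r+1$ be the nilpotency order of $\operatorname{Ad}_{x_2}$ on $x_1$ (assumed to exist), and for $1\le i\le r$ put $M_i=N\big(q_{11}(q_{12}q_{21})^i q_{22}^{\,i^2}\big)$. Then, in $\mathbb N\cup\{\infty\}$, $$\dim\mathfrak B(V)\ \ge\ N_1N_2\prod_{1\le i\le r}M_i .$$ Suppose furthermore that the nilpotency order of $\operatorname{Ad}_{x_1}$ on $x_2$ is $2$. Then: 1. If $r=1$, then $\dim\mathfrak B(V)=N_1N_2M_1$. 2. If $r=2$ and ($N_1\ne 2$ or $N_2\neq 3$), then $\dim\mathfrak B(V)=N_1N_2M_1M_2$. 3. If $r=2$, $N_1=2$ and $N_2=3$, then $\mathfrak B(V)$ is finite-dimensional with $\dim\mathfrak B(V)=N_1N_2M_1M_2$ if and only if $q_{12}q_{21}=-1$, or $q_{12}q_{21}=q_{22}$, or $q_{12}q_{21}=-q_{22}$. -/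

import Mathlib

open scoped TensorProduct DirectSum

noncomputable section

namespace Nichols

universe u v

variable {k : Type u} [Field k] {V : Type v} [AddCommGroup V] [Module k V]

/-! ### Tensor powers and the action of the braid group -/

/-- The identification `V ⊗ V^{⊗n} = V^{⊗(n+1)}`, sending `v ⊗ (v₁ ⊗ ⋯ ⊗ vₙ)` to
`v ⊗ v₁ ⊗ ⋯ ⊗ vₙ`. -/
def cons (k : Type u) [Field k] (V : Type v) [AddCommGroup V] [Module k V] (n : ℕ) :
    V ⊗[k] (⨂[k]^n V) ≃ₗ[k] ⨂[k]^(n + 1) V :=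
  (TensorProduct.congr (PiTensorProduct.subsingletonEquiv (R := k) (s := fun _ : Fin 1 => V) 0).symm
      (LinearEquiv.refl k (⨂[k]^n V))) ≪≫ₗ
    TensorPower.mulEquiv ≪≫ₗ TensorPower.cast k V (Nat.add_comm 1 n)

/-- The identification `(V ⊗ V) ⊗ V^{⊗n} = V^{⊗(n+2)}`. -/
def consTwo (k : Type u) [Field k] (V : Type v) [AddCommGroup V] [Module k V] (n : ℕ) :
    (V ⊗[k] V) ⊗[k] (⨂[k]^n V) ≃ₗ[k] ⨂[k]^(n + 2) V :=
  TensorProduct.assoc k V V (⨂[k]^n V) ≪≫ₗ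
    TensorProduct.congr (LinearEquiv.refl k V) (cons k V n) ≪≫ₗ cons k V (n + 1)

/-- The endomorphism `id_V ⊗ f` of `V^{⊗(n+1)}`, for an endomorphism `f` of `V^{⊗n}`. -/
def shiftEnd {n : ℕ} (f : Module.End k (⨂[k]^n V)) : Module.End k (⨂[k]^(n + 1) V) :=
  (cons k V n).conj (f.lTensor V)

/-- `braidGen c n i` is the action on `V^{⊗n}` of the standard generator of the braid group
that applies `c` to the tensor factors at the positions `i` and `i + 1`; positions are counted
from `0`. (It is the identity if `i + 1 ≥ n`, which is never used.) -/
def braidGen (c : V ⊗[k] V →ₗ[k] V ⊗[k] V) : (n i : ℕ) → Module.End k (⨂[k]^n V)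
  | n + 2, 0 => (consTwo k V n).conj (c.rTensor (⨂[k]^n V))
  | n + 1, i + 1 => shiftEnd (braidGen c n i)
  | 0, _ => 1
  | 1, 0 => 1

/-- `(V, c)` is a braided pair: `c` is a bijective solution of the braid equation
`(c ⊗ id)(id ⊗ c)(c ⊗ id) = (id ⊗ c)(c ⊗ id)(id ⊗ c)` on `V ⊗ V ⊗ V`. -/
structure IsBraiding (c : V ⊗[k] V →ₗ[k] V ⊗[k] V) : Prop where
  bijective : Function.Bijective c
  braid : braidGen c 3 0 * braidGen c 3 1 * braidGen c 3 0 =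
    braidGen c 3 1 * braidGen c 3 0 * braidGen c 3 1

/-- `(V, c)` is of finite group type: there are a basis `x₁, …, xₙ` of `V` and elements
`g₁, …, gₙ` of `GL(V)` generating a finite group, with `c (xᵢ ⊗ xⱼ) = gᵢ(xⱼ) ⊗ xᵢ`. -/
def IsFiniteGroupType (c : V ⊗[k] V →ₗ[k] V ⊗[k] V) : Prop :=
  ∃ (n : ℕ) (x : Module.Basis (Fin n) k V) (g : Fin n → (V ≃ₗ[k] V)),
    (∀ i j, c (x i ⊗ₜ[k] x j) = g i (x j) ⊗ₜ[k] x i) ∧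
      Finite (Subgroup.closure (Set.range g))

/-! ### Positive lifts of permutations, quantum symmetrizers, the Nichols algebra -/

/-- A reduced word of a permutation `x` of `{0, …, n - 1}` in the simple transpositions
`τᵢ = (i i+1)`: if `x 0 = j`, then `x = τ_{j-1} ⋯ τ₁ τ₀ x'`, where `x'` fixes `0` and is
treated recursively as a permutation of `{1, …, n - 1}`. -/
def reducedWord : (n : ℕ) → Equiv.Perm (Fin n) → List ℕ
  | 0, _ => []
  | n + 1, x =>
      (List.range (x 0 : ℕ)).reverse ++
        (reducedWord n (Equiv.Perm.decomposeFin ((x 0).cycleRange * x)).2).map Nat.succ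

/-- The action on `V^{⊗n}` of the lift `s(x)` of a permutation `x` to the braid group:
`s(x) = σ_{i₁} ⋯ σ_{iₗ}` for a reduced expression `x = τ_{i₁} ⋯ τ_{iₗ}`. -/
def permLift (c : V ⊗[k] V →ₗ[k] V ⊗[k] V) (n : ℕ) (x : Equiv.Perm (Fin n)) :
    Module.End k (⨂[k]^n V) :=
  ((reducedWord n x).map (braidGen c n)).prod

/-- The action on `V^{⊗n}` of the quantum symmetrizer `∑_{x ∈ 𝕊ₙ} s(x)`. -/
def quantumSymmetrizer (c : V ⊗[k] V →ₗ[k] V ⊗[k] V) (n : ℕ) : Module.End k (⨂[k]^n V) :=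
  ∑ x : Equiv.Perm (Fin n), permLift c n x

/-- The Nichols algebra of `(V, c)`: the image, inside the tensor coalgebra `⨁ₙ V^{⊗n}`, of the
map from the tensor algebra to the tensor coalgebra whose component of degree `n` is the
quantum symmetrizer. -/
def nicholsAlgebra (c : V ⊗[k] V →ₗ[k] V ⊗[k] V) : Submodule k (⨁ n : ℕ, ⨂[k]^n V) :=
  LinearMap.range (DirectSum.lmap (quantumSymmetrizer c))

/-- The dimension of the Nichols algebra, as an element of `ℕ ∪ {∞}`. -/
def nicholsDim (c : V ⊗[k] V →ₗ[k] V ⊗[k] V) : ℕ∞ :=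
  Cardinal.toENat (Module.rank k (nicholsAlgebra c))

/-! ### The braided adjoint action -/

open Classical in
/-- The sum `T_{i,n-i}` of the lifts `s(x)` of all permutations `x` that are increasing on the
first `i` and on the last `n - i` indices (the inverses of the `(i, n-i)`-shuffles). It is the
component `V^{⊗i} ⊗ V^{⊗(n-i)} → V^{⊗n}` of the multiplication of the tensor coalgebra, and
hence of its braided Hopf subalgebra `nicholsAlgebra c`. -/
def shuffleMul (c : V ⊗[k] V →ₗ[k] V ⊗[k] V) (n i : ℕ) : Module.End k (⨂[k]^n V) :=
  ∑ x : Equiv.Perm (Fin n) with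
    ∀ a b : Fin n, a < b → ((b : ℕ) < i ∨ i ≤ (a : ℕ)) → x a < x b, permLift c n x

/-- The braiding `V ⊗ V^{⊗n} → V^{⊗n} ⊗ V`, as an endomorphism of `V^{⊗(n+1)}`: the first
tensor factor is moved to the end. -/
def braidPast (c : V ⊗[k] V →ₗ[k] V ⊗[k] V) (n : ℕ) : Module.End k (⨂[k]^(n + 1) V) :=
  ((List.range n).reverse.map (braidGen c (n + 1))).prod

/-- The braided adjoint action `Ad_x(y) = x y - m(c(x ⊗ y))` of `x ∈ V`, where `x y` and `m` are
the multiplication of the tensor coalgebra. As the Nichols algebra is a braided Hopf subalgebra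
of the tensor coalgebra, its own adjoint action is the restriction of this map. -/
def Ad (c : V ⊗[k] V →ₗ[k] V ⊗[k] V) (x : V) : Module.End k (⨁ n : ℕ, ⨂[k]^n V) :=
  DirectSum.toModule k ℕ _ fun n =>
    DirectSum.lof k ℕ (fun n => ⨂[k]^n V) (n + 1) ∘ₗ
      (shuffleMul c (n + 1) 1 - shuffleMul c (n + 1) n * braidPast c n) ∘ₗ
        (cons k V n).toLinearMap ∘ₗ TensorProduct.mk k V (⨂[k]^n V) x

/-- An element of `V`, as an element of degree `1` (it lies in the Nichols algebra). -/
def deg1 (k : Type u) [Field k] {V : Type v} [AddCommGroup V] [Module k V] (x : V) :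
    ⨁ n : ℕ, ⨂[k]^n V :=
  DirectSum.lof k ℕ (fun n => ⨂[k]^n V) 1 (PiTensorProduct.tprod k fun _ => x)

/-- The nilpotency order of `T` on `x` is `d`: `d = r + 1` with `T^r x ≠ 0`, `T^{r+1} x = 0`. -/
def HasNilpotencyOrder {X : Type*} [AddCommGroup X] [Module k X] (T : Module.End k X) (x : X)
    (d : ℕ) : Prop :=
  ∃ r : ℕ, d = r + 1 ∧ (T ^ r) x ≠ 0 ∧ (T ^ (r + 1)) x = 0

open Classical in
/-- `N(q)`: the order of `q` if `q ≠ 1` is a root of unity, and `∞` otherwise. -/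
def rootOrder (q : k) : ℕ∞ :=
  if q ≠ 1 ∧ IsOfFinOrder q then (orderOf q : ℕ∞) else ⊤

end Nichols

end

/-!
The proof replaces the Nichols algebra by a concrete ring. Let `QShuffle q` be the space of all
functions on words in the letters `x_i`, with the quantum shuffle product determined by the matrix
`q`. Taking coordinates with respect to the basis of words embeds `⨁ₙ V^{⊗n}` into `QShuffle q`; the
quantum symmetrizer of a word becomes the product of its letters, so the Nichols algebra becomes
the subalgebra generated by the letters (`map_nicholsAlgebra`), and the braided adjoint action
becomes `f ↦ x_a f - (g_a · f) x_a` (`wordMapTotal_Ad`). In `QShuffle q`, stripping the last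
letter of words gives skew derivations `∂_b` (`tailDeriv`), and an element without constant term
that is annihilated by all `∂_b` is zero. Hence identities are proved by differentiating.

Write `z_l = (ad x_j)ˡ(x_i)`, `p = q_{ij} q_{ji}`. Then `∂_j z_l = 0`, and `∂_i z_l` is
`∏_{m < l} (1 - p q_{jj}^m)` times `x_jˡ`; so the nilpotency orders are read off from the matrix.

*Lower bound.* On the kernel of `∂_j` the operator `(∂_j)ᵐ ∂_i` is a skew derivation
(`rootDeriv_mul`). It kills `z_l` for `l < m` and maps `z_m` to a scalar, nonzero for `m ≤ r`.
It therefore lowers the exponent of `z_m` in the monomials `z_r^{e_r} ⋯ z_0^{e_0}` by one, up to a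
`q`-number that does not vanish below the order of `χ_m = q_{ii} pᵐ q_{jj}^{m²}`. These monomials,
multiplied by powers of `x_j`, are thus linearly independent
(`exists_linearIndependent_monomial`).

*Upper bound.* If `(ad x_i)(x_j) ≠ 0` and `(ad x_i)²(x_j) = 0`, then `z_1 x_i` is a multiple of
`x_i z_1`. If `z_3 = 0` and `z_1`, `z_2` commute up to a scalar, the ordered monomials
`x_i^a z_1^b z_2^c x_j^d` therefore span the algebra (`adjoin_le_span_orderedMonomial`), and powers
of the root vectors vanish at the orders of the `χ_m`, so the lower bound is attained. For `r = 1`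
this applies because `z_2 = 0`. For `r = 2` the vectors `z_1`, `z_2` commute up to a scalar exactly
when a polynomial identity in `q_{ii}`, `q_{jj}`, `p` holds (`rootVec_two_mul_rootVec_one`,
`identity_of_mul_eq_smul_mul`). The conditions on the nilpotency orders make it hold, except when
`q_{ii} = -1` and `q_{jj}` is a primitive third root of unity; there it says `p = -1`, `p = q_{jj}`
or `p = -q_{jj}`. If it fails, then `z_1 z_2` is independent of the monomials of the lower bound,
so the dimension is strictly larger or infinite (`exists_mul_eq_smul_mul`).
-/

/-! ### The quantum shuffle algebra -/

/-- The completed quantum shuffle algebra of the braiding of diagonal type with matrix `q`: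
functions on words in the alphabet `ι`. A function `f` stands for the formal sum of all words `w`
with coefficients `f w`. -/
def QShuffle {ι k : Type*} (_q : ι → ι → k) : Type _ := List ι → k

namespace QShuffle

variable {ι k : Type*} [Field k] {q : ι → ι → k}

instance : AddCommGroup (QShuffle q) := inferInstanceAs (AddCommGroup (List ι → k))

instance : Module k (QShuffle q) := inferInstanceAs (Module k (List ι → k))

@[simp] lemma add_apply (f g : QShuffle q) (w : List ι) : (f + g) w = f w + g w := rfl

@[simp] lemma sub_apply (f g : QShuffle q) (w : List ι) : (f - g) w = f w - g w := rfl

@[simp] lemma zero_apply (w : List ι) : (0 : QShuffle q) w = 0 := rfl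

@[simp] lemma smul_apply (a : k) (f : QShuffle q) (w : List ι) : (a • f) w = a * f w := rfl

omit [Field k] in
@[ext] lemma ext {f g : QShuffle q} (h : ∀ w, f w = g w) : f = g := funext h

/-- The left skew derivation that strips the letter `b` from the front of a word. -/
def headDeriv (b : ι) : QShuffle q →ₗ[k] QShuffle q where
  toFun f w := f (b :: w)
  map_add' _ _ := rfl
  map_smul' _ _ := rfl

/-- The right skew derivation that strips the letter `b` from the end of a word. -/
def tailDeriv (b : ι) : QShuffle q →ₗ[k] QShuffle q where
  toFun f w := f (w ++ [b])
  map_add' _ _ := rfl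
  map_smul' _ _ := rfl

/-- The diagonal action of a character `χ` of the free abelian group on the alphabet: a word is
multiplied by the product of the values of `χ` at its letters. -/
def scaleLin (χ : ι → k) : QShuffle q →ₗ[k] QShuffle q where
  toFun f w := (w.map χ).prod * f w
  map_add' f g := funext fun w => mul_add (w.map χ).prod (f w) (g w)
  map_smul' a f := funext fun w => mul_left_comm (w.map χ).prod a (f w)

lemma headDeriv_apply (b : ι) (f : QShuffle q) (w : List ι) : headDeriv b f w = f (b :: w) := rfl

lemma tailDeriv_apply (b : ι) (f : QShuffle q) (w : List ι) : tailDeriv b f w = f (w ++ [b]) := rfl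

lemma scaleLin_apply (χ : ι → k) (f : QShuffle q) (w : List ι) :
    scaleLin χ f w = (w.map χ).prod * f w := rfl

lemma ext_head {f g : QShuffle q} (h0 : f [] = g [])
    (h : ∀ b, headDeriv b f = headDeriv b g) : f = g := by
  ext w
  cases w with
  | nil => exact h0
  | cons b w => exact congrFun (h b) w

lemma ext_tail {f g : QShuffle q} (h0 : f [] = g [])
    (h : ∀ b, tailDeriv b f = tailDeriv b g) : f = g := by
  ext w
  rcases List.eq_nil_or_concat w with rfl | ⟨w, b, rfl⟩
  · exact h0
  · simpa [tailDeriv_apply] using congrFun (h b) w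

lemma headDeriv_scaleLin (χ : ι → k) (b : ι) (f : QShuffle q) :
    headDeriv b (scaleLin χ f) = χ b • scaleLin χ (headDeriv b f) := by
  ext w; simp [headDeriv_apply, scaleLin_apply, mul_assoc]

lemma tailDeriv_scaleLin (χ : ι → k) (b : ι) (f : QShuffle q) :
    tailDeriv b (scaleLin χ f) = χ b • scaleLin χ (tailDeriv b f) := by
  ext w; simp [tailDeriv_apply, scaleLin_apply]; ring

lemma scaleLin_comm (χ ψ : ι → k) (f : QShuffle q) :
    scaleLin χ (scaleLin ψ f) = scaleLin ψ (scaleLin χ f) := by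
  ext w; simp [scaleLin_apply]; ring

lemma headDeriv_tailDeriv (a b : ι) (f : QShuffle q) :
    headDeriv a (tailDeriv b f) = tailDeriv b (headDeriv a f) := rfl

/-- The coefficient of a word in the quantum shuffle product of `f` and `g`. The recursion is the
Leibniz rule `headDeriv_mul` of the left skew derivations. -/
def mulCoeff : List ι → QShuffle q → QShuffle q → k
  | [], f, g => f [] * g []
  | b :: w, f, g =>
      mulCoeff w (headDeriv b f) g + mulCoeff w (scaleLin (fun a => q a b) f) (headDeriv b g)

instance : Mul (QShuffle q) := ⟨fun f g w => mulCoeff w f g⟩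

instance : One (QShuffle q) := ⟨fun w => match w with
  | [] => 1
  | _ :: _ => 0⟩

@[simp] lemma mul_nil (f g : QShuffle q) : (f * g) [] = f [] * g [] := rfl

@[simp] lemma one_nil : (1 : QShuffle q) [] = 1 := rfl

lemma mul_cons (f g : QShuffle q) (b : ι) (w : List ι) : (f * g) (b :: w) =
    (headDeriv b f * g) w + (scaleLin (fun a => q a b) f * headDeriv b g) w := rfl

lemma headDeriv_mul' (f g : QShuffle q) (b : ι) : headDeriv b (f * g) =
    headDeriv b f * g + scaleLin (fun a => q a b) f * headDeriv b g := rfl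

@[simp] lemma headDeriv_one (b : ι) : headDeriv b (1 : QShuffle q) = 0 := rfl

@[simp] lemma tailDeriv_one (b : ι) : tailDeriv b (1 : QShuffle q) = 0 := by
  ext w; cases w <;> rfl

lemma scaleLin_one (χ : ι → k) : scaleLin χ (1 : QShuffle q) = 1 :=
  ext_head (by simp [scaleLin_apply]) fun b => by simp [headDeriv_scaleLin]

protected lemma left_distrib' (f g h : QShuffle q) : f * (g + h) = f * g + f * h := by
  ext w
  induction w generalizing f g h with
  | nil => simp [mul_add]
  | cons b w ih => simp only [mul_cons, add_apply, map_add, ih]; ring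

protected lemma right_distrib' (f g h : QShuffle q) : (f + g) * h = f * h + g * h := by
  ext w
  induction w generalizing f g h with
  | nil => simp [add_mul]
  | cons b w ih => simp only [mul_cons, add_apply, map_add, ih]; ring

protected lemma smul_mul' (a : k) (f g : QShuffle q) : (a • f) * g = a • (f * g) := by
  ext w
  induction w generalizing f g with
  | nil => simp [mul_assoc]
  | cons b w ih => simp only [mul_cons, smul_apply, map_smul, ih]; ring

protected lemma mul_smul' (a : k) (f g : QShuffle q) : f * (a • g) = a • (f * g) := by
  ext w
  induction w generalizing f g with
  | nil => simp [mul_left_comm]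
  | cons b w ih => simp only [mul_cons, smul_apply, map_smul, ih]; ring

protected lemma zero_mul' (f : QShuffle q) : 0 * f = 0 := by
  simpa using QShuffle.smul_mul' (0 : k) 0 f

protected lemma mul_zero' (f : QShuffle q) : f * 0 = 0 := by
  simpa using QShuffle.mul_smul' (0 : k) f 0

lemma scaleLin_mul (χ : ι → k) (f g : QShuffle q) :
    scaleLin χ (f * g) = scaleLin χ f * scaleLin χ g := by
  ext w
  induction w generalizing f g with
  | nil => simp [scaleLin_apply]
  | cons b w ih =>
    change headDeriv b (scaleLin χ (f * g)) w = headDeriv b (scaleLin χ f * scaleLin χ g) w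
    simp only [headDeriv_scaleLin, headDeriv_mul', map_add, smul_apply, add_apply, ih,
      QShuffle.smul_mul', QShuffle.mul_smul', scaleLin_comm (fun a => q a b) χ]
    ring

protected lemma mul_assoc' (f g h : QShuffle q) : f * g * h = f * (g * h) := by
  ext w
  induction w generalizing f g h with
  | nil => simp [mul_assoc]
  | cons b w ih =>
    change headDeriv b (f * g * h) w = headDeriv b (f * (g * h)) w
    simp only [headDeriv_mul', QShuffle.right_distrib', QShuffle.left_distrib', add_apply, ih,
      scaleLin_mul]
    ring

protected lemma one_mul' (f : QShuffle q) : 1 * f = f := by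
  ext w
  induction w generalizing f with
  | nil => simp
  | cons b w ih =>
    simp only [mul_cons, headDeriv_one, QShuffle.zero_mul', scaleLin_one, ih, zero_apply, zero_add]
    rfl

protected lemma mul_one' (f : QShuffle q) : f * 1 = f := by
  ext w
  induction w generalizing f with
  | nil => simp
  | cons b w ih =>
    simp only [mul_cons, headDeriv_one, QShuffle.mul_zero', ih, zero_apply, add_zero]
    rfl

instance : Ring (QShuffle q) where
  __ := (instAddCommGroup : AddCommGroup (QShuffle q))
  left_distrib := QShuffle.left_distrib'
  right_distrib := QShuffle.right_distrib'
  zero_mul := QShuffle.zero_mul'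
  mul_zero := QShuffle.mul_zero'
  mul_assoc := QShuffle.mul_assoc'
  one_mul := QShuffle.one_mul'
  mul_one := QShuffle.mul_one'

instance : Algebra k (QShuffle q) :=
  Algebra.ofModule QShuffle.smul_mul' QShuffle.mul_smul'

/-- The diagonal action of a character is by algebra endomorphisms. -/
def scale (χ : ι → k) : QShuffle q →ₐ[k] QShuffle q :=
  AlgHom.ofLinearMap (scaleLin χ) (scaleLin_one χ) (scaleLin_mul χ)

lemma scale_apply (χ : ι → k) (f : QShuffle q) (w : List ι) :
    scale χ f w = (w.map χ).prod * f w := rfl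

lemma headDeriv_scale (χ : ι → k) (b : ι) (f : QShuffle q) :
    headDeriv b (scale χ f) = χ b • scale χ (headDeriv b f) := headDeriv_scaleLin χ b f

lemma tailDeriv_scale (χ : ι → k) (b : ι) (f : QShuffle q) :
    tailDeriv b (scale χ f) = χ b • scale χ (tailDeriv b f) := tailDeriv_scaleLin χ b f

lemma scale_comm (χ ψ : ι → k) (f : QShuffle q) :
    scale χ (scale ψ f) = scale ψ (scale χ f) := scaleLin_comm χ ψ f

lemma headDeriv_mul (f g : QShuffle q) (b : ι) : headDeriv b (f * g) =
    headDeriv b f * g + scale (fun a => q a b) f * headDeriv b g := rfl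

/-- The Leibniz rule of the right skew derivations. -/
lemma tailDeriv_mul (f g : QShuffle q) (b : ι) : tailDeriv b (f * g) =
    f * tailDeriv b g + tailDeriv b f * scale (q b) g := by
  ext w
  induction w generalizing f g with
  | nil =>
    simp [tailDeriv_apply, mul_cons, headDeriv_apply, scaleLin_apply, scale_apply]
    ring
  | cons a w ih =>
    change tailDeriv b (headDeriv a (f * g)) w =
      headDeriv a (f * tailDeriv b g + tailDeriv b f * scale (q b) g) w
    simp only [headDeriv_mul, map_add, add_apply, ih, headDeriv_tailDeriv, tailDeriv_scale,
      headDeriv_scale, smul_mul_assoc, mul_smul_comm, smul_apply]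
    ring

variable [DecidableEq ι]

/-- The letter `a`, as a word of length one. -/
def letter (q : ι → ι → k) (a : ι) : QShuffle q := fun w => if w = [a] then 1 else 0

@[simp] lemma letter_nil (a : ι) : letter q a [] = 0 := by simp [letter]

lemma headDeriv_letter (a b : ι) : headDeriv b (letter q a) = if b = a then 1 else 0 := by
  ext w
  cases w <;> by_cases h : b = a <;> (simp [headDeriv_apply, letter, h]; try rfl)

lemma tailDeriv_letter (a b : ι) : tailDeriv b (letter q a) = if b = a then 1 else 0 := by
  ext w
  rcases w with _ | ⟨c, w⟩ <;> by_cases h : b = a <;> (simp [tailDeriv_apply, letter, h]; try rfl)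

@[simp] lemma tailDeriv_letter_self (a : ι) : tailDeriv a (letter q a) = 1 := by
  simp [tailDeriv_letter]

lemma tailDeriv_letter_of_ne {a b : ι} (h : b ≠ a) : tailDeriv b (letter q a) = 0 := by
  simp [tailDeriv_letter, h]

@[simp] lemma scale_letter (χ : ι → k) (a : ι) : scale χ (letter q a) = χ a • letter q a := by
  ext w
  by_cases h : w = [a] <;> simp [scale_apply, letter, h]

/-- The braided adjoint action of the letter `a`. -/
def ad (a : ι) : QShuffle q →ₗ[k] QShuffle q where
  toFun f := letter q a * f - scale (q a) f * letter q a
  map_add' f g := by simp only [map_add]; noncomm_ring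
  map_smul' c f := by simp [smul_sub]

lemma ad_apply (a : ι) (f : QShuffle q) :
    ad a f = letter q a * f - scale (q a) f * letter q a := rfl

end QShuffle

/-! ### Linear independence by lowering operators -/

/-- If `T` lowers the index `b` of the vectors `e b i` up to nonzero scalars as long as `b < M`, and
the vectors `e 0 i` annihilated by `T` are linearly independent, then so are all `e b i` with
`b < M`. -/
theorem linearIndependent_of_lowering {k W κ : Type*} [Field k] [AddCommGroup W] [Module k W]
    (T : W →ₗ[k] W) (M : ℕ∞) (e : ℕ → κ → W) (s : ℕ → κ → k) (h0 : ∀ i, T (e 0 i) = 0)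
    (hT : ∀ (b : ℕ) i, T (e (b + 1) i) = s b i • e b i)
    (hs : ∀ (b : ℕ) i, ((b + 1 : ℕ) : ℕ∞) < M → s b i ≠ 0)
    (hli : LinearIndependent k (e 0)) :
    LinearIndependent k (fun p : {b : ℕ // (b : ℕ∞) < M} × κ => e p.1 p.2) := by
  classical
  have hlow : ∀ n b i, b < n → (T ^ n) (e b i) = 0 := by
    intro n
    induction n with
    | zero => intro b i h; omega
    | succ n ih =>
      intro b i h
      rw [pow_succ, Module.End.mul_apply]
      cases b with
      | zero => rw [h0, map_zero]
      | succ b => rw [hT, map_smul, ih b i (by omega), smul_zero]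
  have htop : ∀ n i, ((n : ℕ) : ℕ∞) < M → ∃ c : k, c ≠ 0 ∧ (T ^ n) (e n i) = c • e 0 i := by
    intro n
    induction n with
    | zero => intro i _; exact ⟨1, one_ne_zero, by simp⟩
    | succ n ih =>
      intro i h
      obtain ⟨c, hc, hc'⟩ := ih i (lt_of_le_of_lt (by exact_mod_cast n.le_succ) h)
      exact ⟨s n i * c, mul_ne_zero (hs n i h) hc, by
        rw [pow_succ, Module.End.mul_apply, hT, map_smul, hc', smul_smul]⟩
  suffices H : ∀ n : ℕ, ∀ l : ({b : ℕ // (b : ℕ∞) < M} × κ) →₀ k,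
      (∀ p ∈ l.support, (p.1 : ℕ) < n) →
      Finsupp.linearCombination k (fun p : {b : ℕ // (b : ℕ∞) < M} × κ => e p.1 p.2) l = 0 →
      l = 0 by
    rw [linearIndependent_iff]
    intro l hl
    refine H (l.support.sup (fun p => (p.1 : ℕ)) + 1) l (fun p hp => ?_) hl
    exact Nat.lt_succ_of_le (Finset.le_sup (f := fun p => (p.1 : ℕ)) hp)
  intro n
  induction n with
  | zero =>
    intro l hl _
    rw [← Finsupp.support_eq_empty, Finset.eq_empty_iff_forall_notMem]
    intro p hp
    exact absurd (hl p hp) (by omega)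
  | succ n ih =>
    intro l hl hsum
    refine ih l (fun p hp => ?_) hsum
    by_contra hpn
    have hpn' : (p.1 : ℕ) = n := by have := hl p hp; omega
    choose c hc hc' using fun i => htop n i (hpn' ▸ p.1.2)
    -- only the terms with top index survive `T ^ n`
    have h1 := congrArg (T ^ n) hsum
    rw [Finsupp.linearCombination_apply, Finsupp.sum, map_sum, map_zero,
      ← Finset.sum_filter_of_ne (p := fun p => (p.1 : ℕ) = n)] at h1
    · obtain ⟨S, hS, hSn⟩ : ∃ S : Finset ({b : ℕ // (b : ℕ∞) < M} × κ),
          l.support.filter (fun p => (p.1 : ℕ) = n) = S ∧ ∀ x ∈ S, (x.1 : ℕ) = n :=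
        ⟨_, rfl, fun x hx => (Finset.mem_filter.1 hx).2⟩
      rw [hS] at h1
      have hinj : Function.Injective
          (fun x : (S : Set ({b : ℕ // (b : ℕ∞) < M} × κ)) => x.1.2) := by
        intro x y h
        exact Subtype.ext (Prod.ext (Subtype.ext ((hSn _ x.2).trans (hSn _ y.2).symm)) h)
      have hind : LinearIndepOn k (fun p : {b : ℕ // (b : ℕ∞) < M} × κ => e 0 p.2) S :=
        hli.comp _ hinj
      rw [linearIndepOn_finset_iff] at hind
      have := hind (fun p => l p * c p.2) (by
        rw [← h1]
        refine Finset.sum_congr rfl fun x hx => ?_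
        rw [map_smul, hSn x hx, hc', smul_smul]) p
          (hS ▸ Finset.mem_filter.2 ⟨hp, hpn'⟩)
      exact mul_ne_zero (Finsupp.mem_support_iff.1 hp) (hc _) this
    · intro x hx hne
      by_contra hxn
      have := hl x hx
      exact hne (by rw [map_smul, hlow n _ _ (by omega), smul_zero])

lemma toENat_mk_lt (M : ℕ∞) : Cardinal.toENat (Cardinal.mk {b : ℕ // (b : ℕ∞) < M}) = M := by
  induction M using ENat.recTopCoe with
  | top =>
    have : Infinite {b : ℕ // (b : ℕ∞) < ⊤} :=
      Infinite.of_injective (fun n : ℕ => ⟨n, ENat.natCast_lt_top n⟩) fun a b h => by simpa using h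
    exact Cardinal.toENat_eq_top.2 (Cardinal.aleph0_le_mk _)
  | coe n =>
    have : Cardinal.mk {b : ℕ // (b : ℕ∞) < n} = n := by
      rw [Cardinal.mk_congr (Equiv.subtypeEquivRight (q := fun b => b < n) (by simp))]
      rw [Cardinal.mk_congr (Fin.equivSubtype (n := n)).symm]
      simp
    rw [this]; simp

namespace Nichols

variable {k : Type*} [Field k]

/-- For `n` below `N(q)` the `q`-number `1 + q + ⋯ + q ^ (n - 1)` does not vanish. -/
lemma qNumber_ne_zero [CharZero k] {q : k} {n : ℕ} (hn : n ≠ 0) (h : (n : ℕ∞) < rootOrder q) :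
    ∑ l ∈ Finset.range n, q ^ l ≠ 0 := by
  by_cases hq : q = 1
  · subst hq; simpa using hn
  · intro h0
    have h1 : q ^ n = 1 := by
      have := geom_sum_mul q n
      rw [h0, zero_mul] at this
      exact (sub_eq_zero.1 this.symm)
    have hf : IsOfFinOrder q := isOfFinOrder_iff_pow_eq_one.2 ⟨n, by omega, h1⟩
    rw [rootOrder, if_pos ⟨hq, hf⟩] at h
    have := Nat.le_of_dvd (by omega) (orderOf_dvd_of_pow_eq_one h1)
    exact absurd h (by simpa using this)

lemma eq_of_rootOrder_eq {q : k} {n : ℕ} (h : rootOrder q = n) :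
    q ≠ 1 ∧ 0 < n ∧ orderOf q = n := by
  unfold rootOrder at h
  split_ifs at h with hq
  · have : orderOf q = n := by exact_mod_cast h
    exact ⟨hq.1, this ▸ hq.2.orderOf_pos, this⟩
  · exact absurd h (by simp)

lemma rootOrder_pow_eq_one {q : k} {n : ℕ} (h : rootOrder q = n) : q ^ n = 1 :=
  (eq_of_rootOrder_eq h).2.2 ▸ pow_orderOf_eq_one q

lemma geom_sum_eq_zero_of_pow {q : k} {n : ℕ} (h1 : q ≠ 1) (h : q ^ n = 1) :
    ∑ l ∈ Finset.range n, q ^ l = 0 := by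
  rw [geom_sum_eq h1, h, sub_self, zero_div]

lemma rootOrder_eq_of_orderOf {q : k} {n : ℕ} (hn : 1 < n) (h : orderOf q = n) :
    rootOrder q = n := by
  have h1 : q ≠ 1 := by rintro rfl; simp at h; omega
  rw [rootOrder, if_pos ⟨h1, orderOf_pos_iff.1 (by omega)⟩, h]

end Nichols

namespace QShuffle

variable {ι k : Type*} [Field k] {q : ι → ι → k} [DecidableEq ι]

/-! ### Root vectors -/

/-- The root vector `(ad x_j)ⁿ(x_i)`. -/
def rootVec (q : ι → ι → k) (i j : ι) (n : ℕ) : QShuffle q := ((ad j) ^ n) (letter q i)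

@[simp] lemma rootVec_zero (i j : ι) : rootVec q i j 0 = letter q i := rfl

lemma rootVec_succ (i j : ι) (n : ℕ) : rootVec q i j (n + 1) =
    letter q j * rootVec q i j n - scale (q j) (rootVec q i j n) * letter q j := by
  rw [rootVec, pow_succ', Module.End.mul_apply, ad_apply]; rfl

@[simp] lemma rootVec_nil (i j : ι) (n : ℕ) : rootVec q i j n [] = 0 := by
  cases n <;> simp [rootVec_succ]

lemma scale_rootVec (χ : ι → k) (i j : ι) (n : ℕ) :
    scale χ (rootVec q i j n) = (χ i * χ j ^ n) • rootVec q i j n := by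
  induction n with
  | zero => simp
  | succ n ih =>
    rw [rootVec_succ, map_sub, map_mul, map_mul, scale_comm, ih, scale_letter]
    simp only [map_smul, smul_mul_assoc, mul_smul_comm, smul_sub, smul_smul]
    congr 2 <;> ring

lemma tailDeriv_rootVec_of_ne {i b : ι} (hb : b ≠ i) (j : ι) (n : ℕ) :
    tailDeriv b (rootVec q i j n) = 0 := by
  induction n with
  | zero => exact tailDeriv_letter_of_ne hb
  | succ n ih =>
    rw [rootVec_succ, map_sub, tailDeriv_mul, tailDeriv_mul, tailDeriv_scale, ih, tailDeriv_letter]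
    split_ifs with h
    · simp [h]
    · simp

lemma tailDeriv_letter_pow (j : ι) (n : ℕ) : tailDeriv j (letter q j ^ n) =
    (∑ l ∈ Finset.range n, q j j ^ l) • letter q j ^ (n - 1) := by
  induction n with
  | zero => simp
  | succ n ih =>
    rw [pow_succ', tailDeriv_mul, ih, tailDeriv_letter_self, map_pow, scale_letter, one_mul,
      smul_pow, Finset.sum_range_succ, add_smul, mul_smul_comm]
    rcases n with _ | n
    · simp
    · simp [pow_succ']

lemma tailDeriv_letter_pow_of_ne {b j : ι} (hb : b ≠ j) (n : ℕ) :
    tailDeriv b (letter q j ^ n) = 0 := by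
  induction n with
  | zero => simp
  | succ n ih => rw [pow_succ', tailDeriv_mul, ih, tailDeriv_letter_of_ne hb]; simp

/-- The derivative of a root vector is `∏_{l < n} (1 - q_{ij} q_{ji} q_{jj}^l) x_jⁿ`. -/
lemma tailDeriv_rootVec {i j : ι} (hij : i ≠ j) (n : ℕ) : tailDeriv i (rootVec q i j n) =
    (∏ l ∈ Finset.range n, (1 - q i j * q j i * q j j ^ l)) • letter q j ^ n := by
  induction n with
  | zero => simp
  | succ n ih =>
    rw [rootVec_succ, map_sub, tailDeriv_mul, tailDeriv_mul, tailDeriv_scale, ih,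
      tailDeriv_letter_of_ne hij, scale_letter, Finset.prod_range_succ]
    simp only [zero_mul, mul_zero, add_zero, zero_add, map_smul, map_pow, scale_letter, smul_pow,
      mul_smul_comm, smul_mul_assoc, smul_smul, ← pow_succ, ← pow_succ']
    rw [← sub_smul]
    congr 1; ring

/-- The `q`-factorial. -/
def qFactorial (b : k) (n : ℕ) : k := ∏ m ∈ Finset.range n, ∑ l ∈ Finset.range (m + 1), b ^ l

lemma tailDeriv_pow_letter_pow (j : ι) (n : ℕ) :
    ((tailDeriv j) ^ n) (letter q j ^ n) = qFactorial (q j j) n • 1 := by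
  induction n with
  | zero => simp [qFactorial]
  | succ n ih =>
    rw [pow_succ (tailDeriv j), Module.End.mul_apply, tailDeriv_letter_pow, map_smul,
      Nat.add_sub_cancel, ih, smul_smul, qFactorial, qFactorial, Finset.prod_range_succ, mul_comm]

lemma tailDeriv_pow_letter_pow_of_lt (j : ι) {m n : ℕ} (h : n < m) :
    ((tailDeriv j) ^ m) (letter q j ^ n) = 0 := by
  induction m generalizing n with
  | zero => omega
  | succ m ih =>
    rw [pow_succ (tailDeriv j), Module.End.mul_apply, tailDeriv_letter_pow]
    rcases n with _ | n
    · simp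
    · rw [map_smul, Nat.add_sub_cancel, ih (by omega), smul_zero]

lemma letter_pow_eq_zero_of_qFactorial {j : ι} {n : ℕ} (h : qFactorial (q j j) n = 0) :
    letter q j ^ n = 0 := by
  induction n with
  | zero => simp [qFactorial] at h
  | succ n ih =>
    rw [qFactorial, Finset.prod_range_succ, mul_eq_zero] at h
    rcases h with h | h
    · rw [pow_succ, ih h, zero_mul]
    · refine ext_tail (by simp [pow_succ]) fun b => ?_
      by_cases hb : b = j
      · subst hb; rw [tailDeriv_letter_pow, h]; simp
      · rw [tailDeriv_letter_pow_of_ne hb]; simp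

/-- The coefficient by which `(∂_j)ⁿ ∂_i` maps the root vector `(ad x_j)ⁿ(x_i)` to a scalar. -/
def rootScalar (q : ι → ι → k) (i j : ι) (n : ℕ) : k :=
  (∏ l ∈ Finset.range n, (1 - q i j * q j i * q j j ^ l)) * qFactorial (q j j) n

lemma rootVec_ne_zero_iff {i j : ι} (hij : i ≠ j) (n : ℕ) :
    rootVec q i j n ≠ 0 ↔ rootScalar q i j n ≠ 0 := by
  constructor
  · intro h h0
    apply h
    refine ext_tail (by simp) fun b => ?_
    by_cases hb : b = i
    · subst hb
      rw [tailDeriv_rootVec hij]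
      rcases mul_eq_zero.1 h0 with h0 | h0
      · rw [h0]; simp
      · rw [letter_pow_eq_zero_of_qFactorial h0]; simp
    · rw [tailDeriv_rootVec_of_ne hb]; simp
  · intro h h0
    have h1 := congrArg (fun f => ((tailDeriv j) ^ n) (tailDeriv i f)) h0
    simp only [tailDeriv_rootVec hij, map_smul, tailDeriv_pow_letter_pow, map_zero, smul_smul] at h1
    have h2 := congrFun h1 []
    rw [smul_apply, one_nil, mul_one] at h2
    exact h h2

/-! ### The subalgebra annihilated by one derivation -/

/-- The operator `(∂_j)ᵐ ∂_i`; it is a skew derivation on the kernel of `∂_j`. -/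
def rootDeriv (i j : ι) (m : ℕ) : QShuffle q →ₗ[k] QShuffle q := ((tailDeriv j) ^ m) ∘ₗ tailDeriv i

/-- `f` is homogeneous of degree `a α_i + b α_j`, in terms of the diagonal actions. -/
def IsHomog (i j : ι) (f : QShuffle q) (a b : ℕ) : Prop :=
  ∀ χ : ι → k, scale χ f = (χ i ^ a * χ j ^ b) • f

omit [DecidableEq ι] in
lemma IsHomog.mul {i j : ι} {f g : QShuffle q} {a b a' b' : ℕ} (hf : IsHomog i j f a b)
    (hg : IsHomog i j g a' b') : IsHomog i j (f * g) (a + a') (b + b') := by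
  intro χ
  rw [map_mul, hf, hg, smul_mul_assoc, mul_smul_comm, smul_smul]
  congr 1; ring

omit [DecidableEq ι] in
lemma IsHomog.one (i j : ι) : IsHomog i j (1 : QShuffle q) 0 0 := by
  intro χ; simp

omit [DecidableEq ι] in
lemma IsHomog.pow {i j : ι} {f : QShuffle q} {a b : ℕ} (hf : IsHomog i j f a b) (n : ℕ) :
    IsHomog i j (f ^ n) (n * a) (n * b) := by
  induction n with
  | zero => simpa using IsHomog.one i j
  | succ n ih => rw [pow_succ, Nat.succ_mul, Nat.succ_mul]; exact ih.mul hf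

lemma isHomog_rootVec (i j : ι) (n : ℕ) : IsHomog i j (rootVec q i j n) 1 n := by
  intro χ; rw [scale_rootVec, pow_one]

lemma isHomog_letter (i j : ι) : IsHomog i j (letter q j) 0 1 := by
  intro χ; simp

omit [DecidableEq ι] in
lemma tailDeriv_pow_mul_left {j : ι} {f : QShuffle q} (hf : tailDeriv j f = 0) (h : QShuffle q)
    (m : ℕ) : ((tailDeriv j) ^ m) (f * h) = f * ((tailDeriv j) ^ m) h := by
  induction m generalizing h with
  | zero => simp
  | succ m ih =>
    rw [pow_succ, Module.End.mul_apply, tailDeriv_mul, hf, zero_mul, add_zero, ih,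
      Module.End.mul_apply]

omit [DecidableEq ι] in
lemma tailDeriv_pow_mul_right {j : ι} {g : QShuffle q} (hg : tailDeriv j g = 0) {μ : k}
    (hμ : scale (q j) g = μ • g) (h : QShuffle q) (m : ℕ) :
    ((tailDeriv j) ^ m) (h * g) = μ ^ m • (((tailDeriv j) ^ m) h * g) := by
  induction m generalizing h with
  | zero => simp
  | succ m ih =>
    rw [pow_succ (tailDeriv j), Module.End.mul_apply, tailDeriv_mul, hg, mul_zero, zero_add, hμ,
      mul_smul_comm, map_smul, ih, Module.End.mul_apply, smul_smul, pow_succ']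

omit [DecidableEq ι] in
lemma rootDeriv_mul {i j : ι} {f g : QShuffle q} (hf : tailDeriv j f = 0) (hg : tailDeriv j g = 0)
    {a b : ℕ} (hh : IsHomog i j g a b) (m : ℕ) : rootDeriv i j m (f * g) =
      f * rootDeriv i j m g +
        ((q i i ^ a * q i j ^ b) * (q j i ^ a * q j j ^ b) ^ m) • (rootDeriv i j m f * g) := by
  simp only [rootDeriv, LinearMap.comp_apply]
  rw [tailDeriv_mul, map_add, tailDeriv_pow_mul_left hf, hh (q i), mul_smul_comm, map_smul,
    tailDeriv_pow_mul_right hg (hh (q j)), smul_smul]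

lemma rootDeriv_rootVec_of_lt {i j : ι} (hij : i ≠ j) {m n : ℕ} (h : n < m) :
    rootDeriv i j m (rootVec q i j n) = 0 := by
  rw [rootDeriv, LinearMap.comp_apply, tailDeriv_rootVec hij, map_smul,
    tailDeriv_pow_letter_pow_of_lt j h, smul_zero]

lemma rootDeriv_rootVec {i j : ι} (hij : i ≠ j) (m : ℕ) :
    rootDeriv i j m (rootVec q i j m) = rootScalar q i j m • 1 := by
  rw [rootDeriv, LinearMap.comp_apply, tailDeriv_rootVec hij, map_smul,
    tailDeriv_pow_letter_pow, smul_smul, rootScalar]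

omit [DecidableEq ι] in
lemma tailDeriv_mul_eq_zero {j : ι} {f g : QShuffle q} (hf : tailDeriv j f = 0)
    (hg : tailDeriv j g = 0) : tailDeriv j (f * g) = 0 := by
  rw [tailDeriv_mul, hf, hg]; simp

omit [DecidableEq ι] in
lemma tailDeriv_pow_eq_zero {j : ι} {f : QShuffle q} (hf : tailDeriv j f = 0) (n : ℕ) :
    tailDeriv j (f ^ n) = 0 := by
  induction n with
  | zero => simp
  | succ n ih => rw [pow_succ]; exact tailDeriv_mul_eq_zero ih hf

/-- Homogeneous elements annihilated by `∂_j` and by `(∂_j)ˡ ∂_i` for `l ≥ m`, such as the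
products of the root vectors `(ad x_j)ˡ(x_i)` with `l < m`. -/
structure IsLow (i j : ι) (m : ℕ) (f : QShuffle q) : Prop where
  homog : ∃ a b, IsHomog i j f a b
  tail : tailDeriv j f = 0
  root : ∀ l, m ≤ l → rootDeriv i j l f = 0

omit [DecidableEq ι] in
lemma IsLow.mono {i j : ι} {m n : ℕ} {f : QShuffle q} (h : IsLow i j m f) (hmn : m ≤ n) :
    IsLow i j n f := ⟨h.homog, h.tail, fun l hl => h.root l (hmn.trans hl)⟩

omit [DecidableEq ι] in
lemma IsLow.one (i j : ι) (m : ℕ) : IsLow i j m (1 : QShuffle q) :=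
  ⟨⟨0, 0, IsHomog.one i j⟩, by simp, fun l _ => by simp [rootDeriv]⟩

omit [DecidableEq ι] in
lemma IsLow.mul {i j : ι} {m : ℕ} {f g : QShuffle q} (hf : IsLow i j m f) (hg : IsLow i j m g) :
    IsLow i j m (f * g) := by
  obtain ⟨a, b, hfh⟩ := hf.homog
  obtain ⟨a', b', hgh⟩ := hg.homog
  refine ⟨⟨_, _, hfh.mul hgh⟩, tailDeriv_mul_eq_zero hf.tail hg.tail, fun l hl => ?_⟩
  rw [rootDeriv_mul hf.tail hg.tail hgh, hf.root l hl, hg.root l hl]; simp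

omit [DecidableEq ι] in
lemma IsLow.pow {i j : ι} {m : ℕ} {f : QShuffle q} (hf : IsLow i j m f) (n : ℕ) :
    IsLow i j m (f ^ n) := by
  induction n with
  | zero => exact IsLow.one i j m
  | succ n ih => rw [pow_succ]; exact ih.mul hf

lemma isLow_rootVec {i j : ι} (hij : i ≠ j) (n : ℕ) : IsLow i j (n + 1) (rootVec q i j n) :=
  ⟨⟨1, n, isHomog_rootVec i j n⟩, tailDeriv_rootVec_of_ne hij.symm j n,
    fun _ hl => rootDeriv_rootVec_of_lt hij hl⟩

lemma rootDeriv_rootVec_pow_mul {i j : ι} (hij : i ≠ j) {m : ℕ} {f : QShuffle q}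
    (hf : IsLow i j m f) {a b : ℕ} (hh : IsHomog i j f a b) (n : ℕ) :
    rootDeriv i j m (rootVec q i j m ^ n * f) =
      ((∑ l ∈ Finset.range n, (q i i * (q i j * q j i) ^ m * q j j ^ (m ^ 2)) ^ l) *
        (rootScalar q i j m * ((q i i ^ a * q i j ^ b) * (q j i ^ a * q j j ^ b) ^ m))) •
        (rootVec q i j m ^ (n - 1) * f) := by
  induction n with
  | zero => simp [hf.root m le_rfl]
  | succ n ih =>
    have hlow := ((isLow_rootVec (q := q) hij m).pow n).mul (hf.mono m.le_succ)
    rw [pow_succ', mul_assoc, rootDeriv_mul (tailDeriv_rootVec_of_ne hij.symm j m) hlow.tail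
      (((isHomog_rootVec i j m).pow n).mul hh), ih, rootDeriv_rootVec hij, Finset.sum_range_succ]
    rcases n with _ | n
    · simp [smul_smul, mul_comm]
    · simp only [Nat.add_sub_cancel, mul_smul_comm, smul_mul_assoc, one_mul, smul_smul,
        ← mul_assoc (rootVec q i j m) (rootVec q i j m ^ n) f, ← pow_succ']
      rw [← add_smul]
      congr 1
      ring

/-! ### Independent monomials in the root vectors -/

/-- The monomial `z_{m-1}^{e (m-1)} ⋯ z_0^{e 0}` in the root vectors `z_l = (ad x_j)ˡ(x_i)`. -/
def rootMonomial (q : ι → ι → k) (i j : ι) (e : ℕ → ℕ) : ℕ → QShuffle q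
  | 0 => 1
  | m + 1 => rootVec q i j m ^ e m * rootMonomial q i j e m

lemma rootMonomial_congr {i j : ι} {e e' : ℕ → ℕ} {m : ℕ} (h : ∀ l < m, e l = e' l) :
    rootMonomial q i j e m = rootMonomial q i j e' m := by
  induction m with
  | zero => rfl
  | succ m ih => rw [rootMonomial, rootMonomial, ih fun l hl => h l (by omega), h m (by omega)]

lemma isLow_rootMonomial {i j : ι} (hij : i ≠ j) (e : ℕ → ℕ) (m : ℕ) :
    IsLow i j m (rootMonomial q i j e m) := by
  induction m with
  | zero => exact IsLow.one i j 0
  | succ m ih => exact ((isLow_rootVec hij m).pow _).mul (ih.mono m.le_succ)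

open Nichols in
/-- Independence of the root monomials with exponents below the orders `M l`, by induction on the
number of root vectors: `(∂_j)ᵐ ∂_i` lowers the exponent of the `m`-th one. The index type is left
unspecified; `e` records the exponents and the cardinality is the product of the orders. -/
theorem exists_linearIndependent_rootMonomial [CharZero k] {i j : ι} (hij : i ≠ j)
    (hq : ∀ a b, q a b ≠ 0) (r : ℕ) (hr : ∀ m ≤ r, rootScalar q i j m ≠ 0)
    (M : ℕ → ℕ∞) (hM : ∀ m, M m = rootOrder (q i i * (q i j * q j i) ^ m * q j j ^ (m ^ 2)))
    (m : ℕ) (hm : m ≤ r + 1) :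
    ∃ (κ : Type) (e : κ → ℕ → ℕ),
      Cardinal.toENat (Cardinal.mk κ) = ∏ l ∈ Finset.range m, M l ∧
      (∀ x, ∀ l < m, (e x l : ℕ∞) < M l) ∧
      LinearIndependent k (fun x => rootMonomial q i j (e x) m) := by
  induction m with
  | zero =>
    refine ⟨Unit, fun _ _ => 0, by simp, by simp, ?_⟩
    rw [linearIndependent_unique_iff]
    intro h
    exact one_ne_zero (congrFun h [])
  | succ m ih =>
    obtain ⟨κ, e, hcard, he, hli⟩ := ih (by omega)
    refine ⟨{b : ℕ // (b : ℕ∞) < M m} × κ, fun p => Function.update (e p.2) m p.1, ?_, ?_, ?_⟩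
    · rw [Cardinal.mk_prod, Cardinal.lift_id, Cardinal.lift_id, map_mul, hcard, toENat_mk_lt,
        Finset.prod_range_succ, mul_comm]
    · rintro ⟨b, x⟩ l hl
      rcases Nat.lt_succ_iff_lt_or_eq.1 hl with h | rfl
      · simpa only [Function.update_of_ne h.ne] using he x l h
      · simpa only [Function.update_self] using b.2
    · have hlow := fun x => isLow_rootMonomial (q := q) hij (e x) m
      choose a b hab using fun x => (hlow x).homog
      have := linearIndependent_of_lowering (rootDeriv i j m) (M m)
        (fun n x => rootVec q i j m ^ n * rootMonomial q i j (e x) m) (fun n x =>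
          ((∑ l ∈ Finset.range (n + 1), (q i i * (q i j * q j i) ^ m * q j j ^ (m ^ 2)) ^ l) *
        (rootScalar q i j m * ((q i i ^ a x * q i j ^ b x) * (q j i ^ a x * q j j ^ b x) ^ m))))
        (fun x => by simpa using (hlow x).root m le_rfl)
        (fun n x => by rw [rootDeriv_rootVec_pow_mul hij (hlow x) (hab x), Nat.add_sub_cancel])
        (fun n x hn => mul_ne_zero (qNumber_ne_zero n.succ_ne_zero (hM m ▸ hn))
          (mul_ne_zero (hr m (by omega)) (by simp [hq])))
        (by simpa using hli)
      have heq : (fun p : {b : ℕ // (b : ℕ∞) < M m} × κ =>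
          rootMonomial q i j (Function.update (e p.2) m p.1) (m + 1)) =
          fun p => rootVec q i j m ^ (p.1 : ℕ) * rootMonomial q i j (e p.2) m := by
        funext p
        rw [rootMonomial, Function.update_self,
          rootMonomial_congr (e' := e p.2) fun l hl => Function.update_of_ne hl.ne _ _]
      simpa only [heq] using this

open Nichols in
/-- The monomials in the root vectors and `x_j`, with exponents below the orders of the
corresponding roots of unity, are linearly independent. -/
theorem exists_linearIndependent_monomial [CharZero k] {i j : ι} (hij : i ≠ j)
    (hq : ∀ a b, q a b ≠ 0) (r : ℕ) (hr : ∀ m ≤ r, rootScalar q i j m ≠ 0)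
    (M : ℕ → ℕ∞) (hM : ∀ m, M m = rootOrder (q i i * (q i j * q j i) ^ m * q j j ^ (m ^ 2))) :
    ∃ (κ : Type) (e : κ → ℕ → ℕ) (d : κ → ℕ),
      Cardinal.toENat (Cardinal.mk κ) = rootOrder (q j j) * ∏ l ∈ Finset.range (r + 1), M l ∧
      (∀ x, ∀ l < r + 1, (e x l : ℕ∞) < M l) ∧ (∀ x, (d x : ℕ∞) < rootOrder (q j j)) ∧
      LinearIndependent k (fun x => rootMonomial q i j (e x) (r + 1) * letter q j ^ d x) := by
  obtain ⟨κ, e, hcard, he, hli⟩ :=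
    exists_linearIndependent_rootMonomial hij hq r hr M hM (r + 1) le_rfl
  refine ⟨{b : ℕ // (b : ℕ∞) < rootOrder (q j j)} × κ, fun p => e p.2, fun p => p.1, ?_,
    fun p => he p.2, fun p => p.1.2, ?_⟩
  · rw [Cardinal.mk_prod, Cardinal.lift_id, Cardinal.lift_id, map_mul, hcard, toENat_mk_lt]
  · have hlow := fun x => isLow_rootMonomial (q := q) hij (e x) (r + 1)
    refine linearIndependent_of_lowering (tailDeriv j) (rootOrder (q j j))
      (fun n x => rootMonomial q i j (e x) (r + 1) * letter q j ^ n)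
      (fun n x => ∑ l ∈ Finset.range (n + 1), q j j ^ l)
      (fun x => by simpa using (hlow x).tail) (fun n x => ?_)
      (fun n x hn => qNumber_ne_zero n.succ_ne_zero hn) (by simpa using hli)
    rw [tailDeriv_mul, (hlow x).tail, zero_mul, add_zero, tailDeriv_letter_pow, mul_smul_comm,
      Nat.add_sub_cancel]

end QShuffle

namespace QShuffle

variable {ι k : Type*} [Field k] {q : ι → ι → k} [DecidableEq ι]

/-! ### Relations between root vectors of low degree -/

lemma rootVec_eq_zero_of_le {i j : ι} {m n : ℕ} (h : rootVec q i j m = 0) (hmn : m ≤ n) :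
    rootVec q i j n = 0 := by
  induction n, hmn using Nat.le_induction with
  | base => exact h
  | succ n _ ih => rw [rootVec_succ, ih]; simp

/-- The commutation rule of `x_j` with a root vector. -/
lemma letter_mul_rootVec (i j : ι) (n : ℕ) : letter q j * rootVec q i j n =
    (q j i * q j j ^ n) • (rootVec q i j n * letter q j) + rootVec q i j (n + 1) := by
  rw [rootVec_succ, scale_rootVec, smul_mul_assoc]; abel

lemma letter_mul_letter (i j : ι) : letter q j * letter q i =
    q j i • (letter q i * letter q j) + rootVec q i j 1 := by
  simpa using letter_mul_rootVec (q := q) i j 0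

lemma tailDeriv_rootVec_one {i j : ι} (hij : i ≠ j) :
    tailDeriv i (rootVec q i j 1) = (1 - q i j * q j i) • letter q j := by
  simpa using tailDeriv_rootVec (q := q) hij 1

lemma tailDeriv_rootVec_two {i j : ι} (hij : i ≠ j) : tailDeriv i (rootVec q i j 2) =
    ((1 - q i j * q j i) * (1 - q i j * q j i * q j j)) • (letter q j * letter q j) := by
  simpa [Finset.prod_range_succ, pow_two] using tailDeriv_rootVec (q := q) hij 2

omit [DecidableEq ι] in
lemma ext_of_tailDeriv_eq {i j : ι} (hall : ∀ b, b = i ∨ b = j) {f g : QShuffle q}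
    (h0 : f [] = g []) (hj : tailDeriv j f = tailDeriv j g) (hi : tailDeriv i f = tailDeriv i g) :
    f = g :=
  ext_tail h0 fun b => by rcases hall b with rfl | rfl <;> assumption

section Relations

variable {i j : ι} (hij : i ≠ j) (hall : ∀ b, b = i ∨ b = j)

include hij hall

lemma rootVec_one_mul_letter (hserre : (1 + q i i) * (1 - q i i * (q i j * q j i)) = 0) :
    rootVec q i j 1 * letter q i =
    (q i i * q j i) • (letter q i * rootVec q i j 1) := by
  refine ext_of_tailDeriv_eq hall (by simp) ?_ ?_
  · rw [map_smul, tailDeriv_mul, tailDeriv_mul, tailDeriv_rootVec_of_ne hij.symm,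
      tailDeriv_letter_of_ne hij.symm]; simp
  · rw [map_smul, tailDeriv_mul, tailDeriv_mul, tailDeriv_rootVec_one hij, tailDeriv_letter_self,
      scale_rootVec, scale_letter]
    simp only [mul_one, one_mul, smul_mul_assoc, mul_smul_comm, letter_mul_letter i j]
    match_scalars
    · linear_combination hserre
    · ring

/-- The `B₂`-type relation between the two middle root vectors, under the identity of the matrix
entries that is needed for their derivatives to agree. -/
lemma rootVec_two_mul_rootVec_one (hw : rootVec q i j 3 = 0)
    (h : 1 + (1 - q i j * q j i * q j j) * (q i i * (q i j * q j i) * q j j * (1 + q j j)) =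
      q i i ^ 2 * (q i j * q j i) ^ 3 * q j j ^ 4) :
    rootVec q i j 2 * rootVec q i j 1 =
      (q j i * q j j * (q i i * (q i j * q j i) * q j j)) •
        (rootVec q i j 1 * rootVec q i j 2) := by
  refine ext_of_tailDeriv_eq hall (by simp) ?_ ?_
  · simp only [map_smul, tailDeriv_mul, tailDeriv_rootVec_of_ne hij.symm]; simp
  · have h1 := letter_mul_rootVec (q := q) i j 1
    have h2 := letter_mul_rootVec (q := q) i j 2
    rw [hw, add_zero] at h2
    have h3 : letter q j * letter q j * rootVec q i j 1 =
        (q j i * q j j) ^ 2 • (rootVec q i j 1 * (letter q j * letter q j)) +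
          (q j i * q j j * (1 + q j j)) • (rootVec q i j 2 * letter q j) := by
      rw [mul_assoc, h1, mul_add, h2, mul_smul_comm, ← mul_assoc, h1, add_mul, smul_mul_assoc,
        mul_assoc]
      module
    simp only [map_smul, tailDeriv_mul, tailDeriv_rootVec_one hij,
      tailDeriv_rootVec_two hij, scale_rootVec]
    simp only [smul_mul_assoc, mul_smul_comm, h2, h3]
    match_scalars
    · linear_combination (1 - q i j * q j i) * h
    · ring

end Relations
end QShuffle

/-! ### Spanning monomials -/

section Straightening

variable {k R : Type*} [Field k] [Ring R] [Algebra k R]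

/-- A subspace that contains `1` and is stable under left multiplication by the generators
contains the generated subalgebra. -/
lemma adjoin_le_of_mul_mem {s : Set R} {S : Submodule k R} (h1 : (1 : R) ∈ S)
    (hs : ∀ a ∈ s, ∀ f ∈ S, a * f ∈ S) : Subalgebra.toSubmodule (Algebra.adjoin k s) ≤ S := by
  intro f hf
  suffices H : ∀ g ∈ S, f * g ∈ S by simpa using H 1 h1
  induction (hf : f ∈ Algebra.adjoin k s) using Algebra.adjoin_induction with
  | mem a ha => exact hs a ha
  | algebraMap c => intro g hg; rw [← Algebra.smul_def]; exact S.smul_mem c hg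
  | add f g _ _ hf hg => intro h hh; rw [add_mul]; exact S.add_mem (hf h hh) (hg h hh)
  | mul f g _ _ hf hg => intro h hh; rw [mul_assoc]; exact hf _ (hg h hh)

lemma mul_pow_of_qCommute {u v : R} {c : k} (h : u * v = c • (v * u)) (n : ℕ) :
    u * v ^ n = c ^ n • (v ^ n * u) := by
  induction n with
  | zero => simp
  | succ n ih =>
    rw [pow_succ', ← mul_assoc, h, smul_mul_assoc, mul_assoc, ih, mul_smul_comm, smul_smul,
      ← mul_assoc, pow_succ']

/-- Commuting `y` past `vⁿ` when `y v = c v y + u` and `u` commutes with `v` up to the scalar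
`c χ`. -/
lemma mul_pow_of_qCommute_add {y v u : R} {c χ : k} (h : y * v = c • (v * y) + u)
    (hu : u * v = (c * χ) • (v * u)) (n : ℕ) : y * v ^ (n + 1) =
      c ^ (n + 1) • (v ^ (n + 1) * y) +
        (c ^ n * ∑ l ∈ Finset.range (n + 1), χ ^ l) • (v ^ n * u) := by
  induction n with
  | zero => simpa using h
  | succ n ih =>
    rw [pow_succ' v (n + 1), ← mul_assoc, h, add_mul, smul_mul_assoc, mul_assoc, ih,
      mul_pow_of_qCommute hu (n + 1), mul_add, mul_smul_comm, mul_smul_comm, ← mul_assoc,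
      ← mul_assoc, ← pow_succ', ← pow_succ', Finset.sum_range_succ _ (n + 1)]
    module

/-- Commuting `y` past `vⁿ` when `y v = c v y + u`, where `u` commutes with `v` up to a scalar. -/
lemma exists_mul_pow {y v u : R} {c c' : k} (h : y * v = c • (v * y) + u)
    (hu : u * v = c' • (v * u)) (n : ℕ) :
    ∃ e : k, y * v ^ n = c ^ n • (v ^ n * y) + e • (v ^ (n - 1) * u) := by
  induction n with
  | zero => exact ⟨0, by simp⟩
  | succ n ih =>
    obtain ⟨e, he⟩ := ih
    rcases n with _ | n
    · exact ⟨1, by simpa using h⟩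
    · refine ⟨c * e + c' ^ (n + 1), ?_⟩
      rw [pow_succ' v (n + 1), ← mul_assoc, h, add_mul, smul_mul_assoc, mul_assoc, he,
        mul_pow_of_qCommute hu (n + 1), mul_add, mul_smul_comm, mul_smul_comm, ← mul_assoc,
        ← mul_assoc]
      simp only [Nat.add_sub_cancel, ← pow_succ']
      module

/-- The ordered monomials in `x, z, w, y`. -/
def orderedMonomial (x z w y : R) (p : ℕ × ℕ × ℕ × ℕ) : R :=
  x ^ p.1 * (z ^ p.2.1 * (w ^ p.2.2.1 * y ^ p.2.2.2))

/-- Straightening: under the commutation rules, left multiplication by `x` or `y` maps an ordered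
monomial to a combination of at most three ordered monomials. -/
theorem adjoin_le_span_orderedMonomial {x z w y : R} {t B C α β : k}
    (hyx : y * x = t • (x * y) + z) (hyz : y * z = B • (z * y) + w) (hyw : y * w = C • (w * y))
    (hzx : z * x = α • (x * z)) (hwz : w * z = β • (z * w)) :
    Subalgebra.toSubmodule (Algebra.adjoin k {x, y}) ≤
      Submodule.span k (Set.range (orderedMonomial x z w y)) := by
  have hmem : ∀ a b c d, x ^ a * (z ^ b * (w ^ c * y ^ d)) ∈
      Submodule.span k (Set.range (orderedMonomial x z w y)) :=
    fun a b c d => Submodule.subset_span ⟨(a, b, c, d), rfl⟩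
  have hclosed : ∀ g : R, (∀ p, g * orderedMonomial x z w y p ∈
      Submodule.span k (Set.range (orderedMonomial x z w y))) →
      ∀ f ∈ Submodule.span k (Set.range (orderedMonomial x z w y)), g * f ∈
        Submodule.span k (Set.range (orderedMonomial x z w y)) := by
    intro g hg f hf
    induction hf using Submodule.span_induction with
    | mem f hf => obtain ⟨p, rfl⟩ := hf; exact hg p
    | zero => simp
    | add f f' _ _ hf hf' => rw [mul_add]; exact Submodule.add_mem _ hf hf'
    | smul c f _ hf => rw [mul_smul_comm]; exact Submodule.smul_mem _ c hf
  refine adjoin_le_of_mul_mem ?_ ?_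
  · simpa using hmem 0 0 0 0
  rintro g hg
  apply hclosed
  rintro ⟨a, b, c, d⟩
  rcases hg with rfl | rfl
  · rw [orderedMonomial, ← mul_assoc, ← pow_succ']
    exact hmem _ _ _ _
  · obtain ⟨e, he⟩ := exists_mul_pow hyx hzx a
    obtain ⟨e', he'⟩ := exists_mul_pow hyz hwz b
    have h1 : g * x ^ a * (z ^ b * (w ^ c * g ^ d)) =
        (t ^ a * B ^ b * C ^ c) • (x ^ a * (z ^ b * (w ^ c * g ^ (d + 1)))) +
        (t ^ a * e') • (x ^ a * (z ^ (b - 1) * (w ^ (c + 1) * g ^ d))) +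
        e • (x ^ (a - 1) * (z ^ (b + 1) * (w ^ c * g ^ d))) := by
      have h2 : g * (z ^ b * (w ^ c * g ^ d)) = (B ^ b * C ^ c) • (z ^ b * (w ^ c * g ^ (d + 1))) +
          e' • (z ^ (b - 1) * (w ^ (c + 1) * g ^ d)) := by
        rw [← mul_assoc, he', add_mul, smul_mul_assoc, smul_mul_assoc, mul_assoc (z ^ b),
          ← mul_assoc g, mul_pow_of_qCommute hyw, smul_mul_assoc, mul_smul_comm, smul_smul,
          mul_assoc (w ^ c), ← pow_succ', mul_assoc (z ^ (b - 1)), ← mul_assoc w, ← pow_succ']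
      rw [he, add_mul, smul_mul_assoc, smul_mul_assoc, mul_assoc, h2, mul_add, mul_smul_comm,
        mul_smul_comm, mul_assoc, ← mul_assoc z, ← pow_succ']
      module
    rw [orderedMonomial, ← mul_assoc, h1]
    exact Submodule.add_mem _ (Submodule.add_mem _ (Submodule.smul_mem _ _ (hmem _ _ _ _))
      (Submodule.smul_mem _ _ (hmem _ _ _ _))) (Submodule.smul_mem _ _ (hmem _ _ _ _))

lemma toENat_rank_le_of_span_orderedMonomial {x z w y : R} {S : Submodule k R}
    (hS : S ≤ Submodule.span k (Set.range (orderedMonomial x z w y))) {N₁ M₁ M₂ N₂ : ℕ∞}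
    (hx : ∀ n : ℕ, N₁ = n → x ^ n = 0) (hz : ∀ n : ℕ, M₁ = n → z ^ n = 0)
    (hw : ∀ n : ℕ, M₂ = n → w ^ n = 0) (hy : ∀ n : ℕ, N₂ = n → y ^ n = 0) :
    Cardinal.toENat (Module.rank k S) ≤ N₁ * (M₁ * (M₂ * N₂)) := by
  have hpow : ∀ (u : R) (N : ℕ∞), (∀ n : ℕ, N = n → u ^ n = 0) → ∀ m : ℕ, ¬ (m : ℕ∞) < N →
      u ^ m = 0 := by
    intro u N h m hm
    induction N using ENat.recTopCoe with
    | top => exact absurd (ENat.natCast_lt_top m) hm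
    | coe n => exact pow_eq_zero_of_le (by simpa using hm) (h n rfl)
  let κ := {b : ℕ // (b : ℕ∞) < N₁} × {b : ℕ // (b : ℕ∞) < M₁} × {b : ℕ // (b : ℕ∞) < M₂} ×
    {b : ℕ // (b : ℕ∞) < N₂}
  let v : κ → R := fun p => orderedMonomial x z w y (p.1, p.2.1, p.2.2.1, p.2.2.2)
  have hle : S ≤ Submodule.span k (Set.range v) := by
    refine hS.trans (Submodule.span_le.2 ?_)
    rintro _ ⟨⟨a, b, c, d⟩, rfl⟩
    by_cases ha : (a : ℕ∞) < N₁
    · by_cases hb : (b : ℕ∞) < M₁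
      · by_cases hc : (c : ℕ∞) < M₂
        · by_cases hd : (d : ℕ∞) < N₂
          · exact Submodule.subset_span ⟨(⟨a, ha⟩, ⟨b, hb⟩, ⟨c, hc⟩, ⟨d, hd⟩), rfl⟩
          · simp [orderedMonomial, hpow y N₂ hy d hd]
        · simp [orderedMonomial, hpow w M₂ hw c hc]
      · simp [orderedMonomial, hpow z M₁ hz b hb]
    · simp [orderedMonomial, hpow x N₁ hx a ha]
  have h1 : Module.rank k S ≤ Cardinal.mk (Set.range v) :=
    (Submodule.rank_mono hle).trans (rank_span_le _)
  have h2 := Cardinal.mk_range_le_lift (f := v)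
  have h3 : Cardinal.toENat (Cardinal.mk κ) = N₁ * (M₁ * (M₂ * N₂)) := by
    simp only [κ, Cardinal.mk_prod, Cardinal.lift_id, map_mul, toENat_mk_lt]
  rw [← h3]
  refine (OrderHomClass.mono Cardinal.toENat h1).trans ?_
  have := OrderHomClass.mono Cardinal.toENat h2
  simpa using this

end Straightening

namespace QShuffle

variable {ι k : Type*} [Field k] {q : ι → ι → k} [DecidableEq ι]

/-! ### Nilpotency of the root vectors -/

/-- The double geometric sum `∑_{m < M} χᵐ (1 + χ + ⋯ + χ^(m-1))` vanishes if `χ` is an `M`-th root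
of unity with `χ² ≠ 1`. -/
lemma sum_pow_mul_geom_sum {χ : k} {M : ℕ} (h : χ ^ M = 1) (h2 : χ ^ 2 ≠ 1) :
    ∑ m ∈ Finset.range M, χ ^ m * ∑ l ∈ Finset.range m, χ ^ l = 0 := by
  have h1 : χ ≠ 1 := by rintro rfl; simp at h2
  have h3 : (∑ m ∈ Finset.range M, χ ^ m * ∑ l ∈ Finset.range m, χ ^ l) * (χ - 1) =
      ∑ m ∈ Finset.range M, (χ ^ 2) ^ m - ∑ m ∈ Finset.range M, χ ^ m := by
    rw [Finset.sum_mul, ← Finset.sum_sub_distrib]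
    refine Finset.sum_congr rfl fun m _ => ?_
    rw [mul_assoc, geom_sum_mul]; ring
  rw [Nichols.geom_sum_eq_zero_of_pow h1 h, Nichols.geom_sum_eq_zero_of_pow h2
    (by rw [← pow_mul, mul_comm, pow_mul, h, one_pow]), sub_zero] at h3
  exact (mul_eq_zero.1 h3).resolve_right (sub_ne_zero.2 h1)

lemma letter_pow_eq_zero {j : ι} {n : ℕ} (hn : 0 < n) (h : ∑ l ∈ Finset.range n, q j j ^ l = 0) :
    letter q j ^ n = 0 := by
  obtain ⟨n, rfl⟩ : ∃ m, n = m + 1 := ⟨n - 1, by omega⟩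
  exact letter_pow_eq_zero_of_qFactorial (by rw [qFactorial, Finset.prod_range_succ, h, mul_zero])

section

variable {i j : ι} (hij : i ≠ j) (hall : ∀ b, b = i ∨ b = j)

include hij hall

/-- The derivative of `z_1ⁿ` is a combination of `z_1^(n-1) x_j` and `z_1^(n-2) z_2`; both
coefficients vanish when `n` is the order of `χ = q_{ii} q_{ij} q_{ji} q_{jj}`. -/
lemma rootVec_one_pow_eq_zero (htq : q j i * q j j ≠ 0)
    (hwz : rootVec q i j 2 * rootVec q i j 1 =
      (q j i * q j j * (q i i * (q i j * q j i) * q j j)) •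
        (rootVec q i j 1 * rootVec q i j 2)) {M : ℕ} (hM : 0 < M)
    (h1 : q i i * (q i j * q j i) * q j j ≠ 1)
    (h : (q i i * (q i j * q j i) * q j j) ^ M = 1)
    (h2 : (q i i * (q i j * q j i) * q j j) ^ 2 ≠ 1 ∨ rootVec q i j 2 = 0) :
    rootVec q i j 1 ^ M = 0 := by
  obtain ⟨χ, hχ⟩ : ∃ χ, χ = q i i * (q i j * q j i) * q j j := ⟨_, rfl⟩
  rw [← hχ] at hwz h1 h h2
  have hyz : letter q j * rootVec q i j 1 =
      (q j i * q j j) • (rootVec q i j 1 * letter q j) + rootVec q i j 2 := by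
    simpa using letter_mul_rootVec (q := q) i j 1
  have key : ∀ n : ℕ, (q j i * q j j) • tailDeriv i (rootVec q i j 1 ^ n) =
      (1 - q i j * q j i) • (((q j i * q j j) * ∑ l ∈ Finset.range n, χ ^ l) •
        (rootVec q i j 1 ^ (n - 1) * letter q j) +
        (∑ m ∈ Finset.range n, χ ^ m * ∑ l ∈ Finset.range m, χ ^ l) •
          (rootVec q i j 1 ^ (n - 2) * rootVec q i j 2)) := by
    intro n
    induction n with
    | zero => simp
    | succ n ih =>
      rw [pow_succ', tailDeriv_mul, smul_add, ← mul_smul_comm, ih, tailDeriv_rootVec_one hij,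
        map_pow, scale_rootVec]
      rcases n with _ | _ | n
      · simp [smul_smul, mul_comm]
      · simp only [zero_add, pow_one, pow_zero, Finset.sum_range_succ, Finset.sum_range_zero,
          smul_mul_assoc, mul_smul_comm, one_mul, hyz, hχ, Nat.sub_self, Nat.add_sub_cancel,
          Nat.reduceSub, mul_add, mul_one, mul_zero, zero_smul, add_zero]
        match_scalars <;> ring
      · rw [smul_pow, smul_mul_assoc, mul_smul_comm (_ ^ _) (letter q j),
          mul_pow_of_qCommute_add hyz hwz (n + 1)]
        have e1 : rootVec q i j 1 * (rootVec q i j 1 ^ (n + 1) * letter q j) =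
            rootVec q i j 1 ^ (n + 1 + 1) * letter q j := by rw [← mul_assoc, ← pow_succ']
        have e2 : rootVec q i j 1 * (rootVec q i j 1 ^ n * rootVec q i j 2) =
            rootVec q i j 1 ^ (n + 1) * rootVec q i j 2 := by rw [← mul_assoc, ← pow_succ']
        simp only [Nat.add_sub_cancel, show n + 1 + 1 + 1 - 2 = n + 1 by omega,
          show n + 1 + 1 - 2 = n by omega, mul_smul_comm, mul_add, e1, e2,
          Finset.sum_range_succ _ (n + 1 + 1)]
        generalize ∑ l ∈ Finset.range (n + 1 + 1), χ ^ l = S1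
        generalize ∑ m ∈ Finset.range (n + 1 + 1), χ ^ m * ∑ l ∈ Finset.range m, χ ^ l = S2
        have e3 : χ ^ (n + 1 + 1) =
            (q i i * q i j) ^ (n + 1 + 1) * (q j i * q j j) ^ (n + 1 + 1) := by
          rw [hχ, ← mul_pow]; congr 1; ring
        rw [e3]
        match_scalars <;> ring
  refine ext_of_tailDeriv_eq hall ?_ ?_ ?_
  · obtain ⟨n, rfl⟩ : ∃ n, M = n + 1 := ⟨M - 1, by omega⟩
    simp [pow_succ]
  · rw [tailDeriv_pow_eq_zero (tailDeriv_rootVec_of_ne hij.symm j 1), map_zero]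
  · have := key M
    rw [Nichols.geom_sum_eq_zero_of_pow h1 h] at this
    have h3 : (∑ m ∈ Finset.range M, χ ^ m * ∑ l ∈ Finset.range m, χ ^ l) •
          (rootVec q i j 1 ^ (M - 2) * rootVec q i j 2) = 0 := by
      rcases h2 with h2 | h2
      · rw [sum_pow_mul_geom_sum h h2, zero_smul]
      · rw [h2, mul_zero, smul_zero]
    rw [h3] at this
    simpa [htq] using this

lemma rootVec_two_pow_eq_zero (hw : rootVec q i j 3 = 0) {M : ℕ} (hM : 0 < M)
    (h1 : q i i * (q i j * q j i) ^ 2 * q j j ^ 4 ≠ 1)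
    (h : (q i i * (q i j * q j i) ^ 2 * q j j ^ 4) ^ M = 1) :
    rootVec q i j 2 ^ M = 0 := by
  obtain ⟨χ, hχ⟩ : ∃ χ, χ = q i i * (q i j * q j i) ^ 2 * q j j ^ 4 := ⟨_, rfl⟩
  rw [← hχ] at h1 h
  have hyw : letter q j * rootVec q i j 2 =
      (q j i * q j j ^ 2) • (rootVec q i j 2 * letter q j) := by
    simpa [hw] using letter_mul_rootVec (q := q) i j 2
  have key : ∀ n : ℕ, tailDeriv i (rootVec q i j 2 ^ n) =
      (((1 - q i j * q j i) * (1 - q i j * q j i * q j j)) * ∑ l ∈ Finset.range n, χ ^ l) •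
        (rootVec q i j 2 ^ (n - 1) * (letter q j * letter q j)) := by
    intro n
    induction n with
    | zero => simp
    | succ n ih =>
      have hc := mul_pow_of_qCommute hyw n
      rw [pow_succ', tailDeriv_mul, ih, tailDeriv_rootVec_two hij, map_pow, scale_rootVec,
        smul_pow, smul_mul_assoc, mul_smul_comm, mul_smul_comm,
        mul_assoc (letter q j) (letter q j), hc, mul_smul_comm,
        ← mul_assoc (letter q j), hc, smul_mul_assoc, mul_assoc _ (letter q j) (letter q j)]
      rcases n with _ | n
      · simp
      · simp only [Nat.add_sub_cancel, ← mul_assoc (rootVec q i j 2) (rootVec q i j 2 ^ n),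
          ← pow_succ', Finset.sum_range_succ _ (n + 1)]
        have e3 : χ ^ (n + 1) = (q i i ^ 1 * q i j ^ 2) ^ (n + 1) * (q j i * q j j ^ 2) ^ (n + 1) *
            (q j i * q j j ^ 2) ^ (n + 1) := by
          rw [hχ, ← mul_pow, ← mul_pow]; congr 1; ring
        rw [e3]
        match_scalars
        ring
  refine ext_of_tailDeriv_eq hall ?_ ?_ ?_
  · obtain ⟨n, rfl⟩ : ∃ n, M = n + 1 := ⟨M - 1, by omega⟩
    simp [pow_succ]
  · rw [tailDeriv_pow_eq_zero (tailDeriv_rootVec_of_ne hij.symm j 2), map_zero]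
  · rw [key, Nichols.geom_sum_eq_zero_of_pow h1 h]; simp

end

end QShuffle

/-! ### Dimension bounds in the quantum shuffle algebra -/

namespace QShuffle

variable {ι k : Type*} [Field k] {q : ι → ι → k} [DecidableEq ι]

variable (q) in
/-- The subalgebra of the quantum shuffle algebra generated by the letters; it is isomorphic to the
Nichols algebra of the braiding of diagonal type with matrix `q`. -/
def letterAlgebra : Subalgebra k (QShuffle q) := Algebra.adjoin k (Set.range (letter q))

lemma letter_mem (i : ι) : letter q i ∈ letterAlgebra q := Algebra.subset_adjoin ⟨i, rfl⟩

lemma rootVec_mem (i j : ι) (n : ℕ) : rootVec q i j n ∈ letterAlgebra q := by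
  induction n with
  | zero => exact letter_mem i
  | succ n ih =>
    rw [rootVec_succ, scale_rootVec, smul_mul_assoc]
    exact sub_mem (mul_mem (letter_mem j) ih) (Subalgebra.smul_mem _ (mul_mem ih (letter_mem j)) _)

lemma rootMonomial_mem (i j : ι) (e : ℕ → ℕ) (m : ℕ) :
    rootMonomial q i j e m ∈ letterAlgebra q := by
  induction m with
  | zero => exact one_mem _
  | succ m ih => exact mul_mem (pow_mem (rootVec_mem i j m) _) ih

variable (q) in
/-- The dimension of the subalgebra generated by the letters. -/
noncomputable def letterDim : ℕ∞ :=
  Cardinal.toENat (Module.rank k (Subalgebra.toSubmodule (letterAlgebra q)))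

lemma toENat_mk_le_rank {W : Type*} [AddCommGroup W] [Module k W] {S : Submodule k W}
    {κ : Type} {v : κ → W} (hv : LinearIndependent k v) (hS : ∀ x, v x ∈ S) :
    Cardinal.toENat (Cardinal.mk κ) ≤ Cardinal.toENat (Module.rank k S) := by
  have h : LinearIndependent k (fun x => (⟨v x, hS x⟩ : S)) :=
    LinearIndependent.of_comp S.subtype hv
  have := OrderHomClass.mono Cardinal.toENat h.cardinal_lift_le_rank
  simpa using this

/-- A linearly independent family in a finite-dimensional subspace `S`, of cardinality `dim S`,
spans `S`. -/
lemma le_span_of_toENat_rank_eq {W : Type*} [AddCommGroup W] [Module k W] {S : Submodule k W}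
    {κ : Type} {v : κ → W} (hv : LinearIndependent k v) (hS : ∀ x, v x ∈ S)
    (hfin : Cardinal.toENat (Module.rank k S) ≠ ⊤)
    (heq : Cardinal.toENat (Cardinal.mk κ) = Cardinal.toENat (Module.rank k S)) :
    S ≤ Submodule.span k (Set.range v) := by
  have h1 : Module.rank k S < Cardinal.aleph0 := by
    rw [← not_le]; exact fun h => hfin (Cardinal.toENat_eq_top.2 h)
  have h2 : Cardinal.mk κ < Cardinal.aleph0 := by
    rw [← not_le]; exact fun h => hfin (heq ▸ Cardinal.toENat_eq_top.2 h)
  have : Module.Finite k S := Module.rank_lt_aleph0_iff.1 h1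
  have : Fintype κ := @Fintype.ofFinite κ (Cardinal.lt_aleph0_iff_finite.1 h2)
  have hle : Submodule.span k (Set.range v) ≤ S := Submodule.span_le.2 (by
    rintro _ ⟨x, rfl⟩; exact hS x)
  refine (Submodule.eq_of_le_of_finrank_eq hle ?_).ge
  rw [finrank_span_eq_card hv]
  rw [← Module.finrank_eq_rank, Cardinal.mk_fintype, Cardinal.toENat_nat,
    Cardinal.toENat_nat] at heq
  exact_mod_cast heq

open Nichols

section

variable {i j : ι} (hij : i ≠ j)

include hij

lemma rootScalar_ne_zero_of_le {r : ℕ} (hr : rootVec q i j r ≠ 0) (m : ℕ) (hm : m ≤ r) :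
    rootScalar q i j m ≠ 0 := by
  rw [← rootVec_ne_zero_iff hij]
  exact fun h => hr (rootVec_eq_zero_of_le h hm)

/-- The dimension is at least the product of the orders attached to `x_j` and to the root vectors
`z_0, …, z_r`. -/
theorem le_letterDim [CharZero k] (hq : ∀ a b, q a b ≠ 0) {r : ℕ} (hr : rootVec q i j r ≠ 0)
    (M : ℕ → ℕ∞) (hM : ∀ m, M m = rootOrder (q i i * (q i j * q j i) ^ m * q j j ^ (m ^ 2))) :
    rootOrder (q j j) * ∏ l ∈ Finset.range (r + 1), M l ≤ letterDim q := by
  obtain ⟨κ, e, d, hcard, -, -, hli⟩ := exists_linearIndependent_monomial hij hq r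
    (rootScalar_ne_zero_of_le hij hr) M hM
  rw [← hcard]
  exact toENat_mk_le_rank hli fun x =>
    (letterAlgebra q).mul_mem (rootMonomial_mem i j _ _) (pow_mem (letter_mem j) _)

/-- The scalar form of the condition that `(ad x_i)²(x_j) = 0` and `(ad x_i)(x_j) ≠ 0`. -/
lemma serre_of_rootVec_eq_zero (h1 : rootVec q j i 1 ≠ 0) (h2 : rootVec q j i 2 = 0) :
    (1 + q i i) * (1 - q i i * (q i j * q j i)) = 0 := by
  have h3 := (rootVec_ne_zero_iff hij.symm 1).1 h1
  have h4 : rootScalar q j i 2 = 0 := by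
    by_contra h; exact (rootVec_ne_zero_iff hij.symm 2).2 h h2
  simp only [rootScalar, qFactorial, Finset.prod_range_succ, Finset.prod_range_zero,
    Finset.sum_range_succ, Finset.sum_range_zero] at h3 h4
  have h5 : (1 - q j i * q i j) ≠ 0 := fun h => h3 (by simp [h])
  have h6 : (1 - q j i * q i j) * ((1 + q i i) * (1 - q i i * (q i j * q j i))) = 0 := by
    linear_combination h4
  exact (mul_eq_zero.1 h6).resolve_left h5

variable (hall : ∀ b, b = i ∨ b = j)

include hall

/-- The upper bound when `z_3 = 0` and `z_1`, `z_2` commute up to a scalar. The exponent of `z_2` is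
bounded by an arbitrary `M₂`, which is `1` when `z_2 = 0`. -/
theorem letterDim_le [CharZero k] (hq : ∀ a b, q a b ≠ 0)
    (hserre : (1 + q i i) * (1 - q i i * (q i j * q j i)) = 0) (hw : rootVec q i j 3 = 0)
    (hwz : rootVec q i j 2 * rootVec q i j 1 =
      (q j i * q j j * (q i i * (q i j * q j i) * q j j)) •
        (rootVec q i j 1 * rootVec q i j 2))
    (h2 : rootOrder (q i i * (q i j * q j i) * q j j) ≠ ⊤ →
      (q i i * (q i j * q j i) * q j j) ^ 2 ≠ 1 ∨ rootVec q i j 2 = 0)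
    {M₂ : ℕ∞} (hM₂ : ∀ n : ℕ, M₂ = n → rootVec q i j 2 ^ n = 0) :
    letterDim q ≤ rootOrder (q i i) *
      (rootOrder (q i i * (q i j * q j i) * q j j) * (M₂ * rootOrder (q j j))) := by
  have hset : Set.range (letter q) = {letter q i, letter q j} := by
    ext f
    constructor
    · rintro ⟨b, rfl⟩
      rcases hall b with rfl | rfl <;> simp
    · rintro (rfl | rfl) <;> exact ⟨_, rfl⟩
  have hpow : ∀ a (n : ℕ), rootOrder (q a a) = n → letter q a ^ n = 0 := fun a n hn =>
    letter_pow_eq_zero (eq_of_rootOrder_eq hn).2.1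
      (geom_sum_eq_zero_of_pow (eq_of_rootOrder_eq hn).1 (rootOrder_pow_eq_one hn))
  refine toENat_rank_le_of_span_orderedMonomial (x := letter q i) (z := rootVec q i j 1)
    (w := rootVec q i j 2) (y := letter q j) ?_ (hpow i) (fun n hn => ?_) hM₂ (hpow j)
  · rw [letterAlgebra, hset]
    exact adjoin_le_span_orderedMonomial (letter_mul_letter i j) (letter_mul_rootVec i j 1)
      (by simpa [hw] using letter_mul_rootVec (q := q) i j 2)
      (rootVec_one_mul_letter hij hall hserre) hwz
  · exact rootVec_one_pow_eq_zero hij hall (mul_ne_zero (hq _ _) (hq _ _)) hwz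
      (eq_of_rootOrder_eq hn).2.1 (eq_of_rootOrder_eq hn).1 (rootOrder_pow_eq_one hn)
      (h2 (by simp [hn]))

theorem letterDim_eq_of_rootVec_two_eq_zero [CharZero k] (hq : ∀ a b, q a b ≠ 0)
    (hserre : (1 + q i i) * (1 - q i i * (q i j * q j i)) = 0)
    (h1 : rootVec q i j 1 ≠ 0) (h2 : rootVec q i j 2 = 0) :
    letterDim q = rootOrder (q j j) *
      (rootOrder (q i i) * rootOrder (q i i * (q i j * q j i) * q j j)) := by
  refine le_antisymm ?_ ?_
  · have := letterDim_le hij hall hq hserre (rootVec_eq_zero_of_le h2 (by omega)) (by simp [h2])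
      (fun _ => Or.inr h2) (M₂ := 1) (fun n hn => by
        obtain rfl : n = 1 := by exact_mod_cast hn.symm
        rw [pow_one, h2])
    refine this.trans (le_of_eq ?_)
    ring
  · have := le_letterDim hij hq h1 _ fun m => rfl
    simpa [Finset.prod_range_succ] using this

/-- Under the Serre relations of type `B₂`, the dimension is the product of the orders as soon as
the two middle root vectors commute up to a scalar. -/
theorem letterDim_eq_of_rootVec_three_eq_zero [CharZero k] (hq : ∀ a b, q a b ≠ 0)
    (hserre : (1 + q i i) * (1 - q i i * (q i j * q j i)) = 0)
    (h2 : rootVec q i j 2 ≠ 0) (h3 : rootVec q i j 3 = 0)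
    (h : 1 + (1 - q i j * q j i * q j j) * (q i i * (q i j * q j i) * q j j * (1 + q j j)) =
      q i i ^ 2 * (q i j * q j i) ^ 3 * q j j ^ 4) :
    letterDim q = rootOrder (q j j) *
      (rootOrder (q i i) * rootOrder (q i i * (q i j * q j i) * q j j) *
        rootOrder (q i i * (q i j * q j i) ^ 2 * q j j ^ 4)) := by
  refine le_antisymm ?_ ?_
  · have h5 := rootScalar_ne_zero_of_le hij h2 2 le_rfl
    simp only [rootScalar, qFactorial, Finset.prod_range_succ, Finset.prod_range_zero,
      Finset.sum_range_succ, Finset.sum_range_zero] at h5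
    have h6 : 1 + q j j ≠ 0 := fun h => h5 (by simp [h])
    have h7 : 1 - q i j * q j i * q j j ≠ 0 := fun h => h5 (by simp [h])
    have := letterDim_le hij hall hq hserre h3
      (rootVec_two_mul_rootVec_one hij hall h3 h) (fun hM => Or.inl fun hsq => ?_)
      (M₂ := rootOrder (q i i * (q i j * q j i) ^ 2 * q j j ^ 4)) (fun n hn =>
        rootVec_two_pow_eq_zero hij hall h3 (eq_of_rootOrder_eq hn).2.1
          (eq_of_rootOrder_eq hn).1 (rootOrder_pow_eq_one hn))
    · refine this.trans (le_of_eq ?_)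
      ring
    · -- `χ ≠ 1` because its order is finite, and `χ = -1` contradicts `z_2 ≠ 0`
      obtain ⟨n, hn⟩ := ENat.ne_top_iff_exists.1 hM
      have h1 := (eq_of_rootOrder_eq hn.symm).1
      have h8 : q i i * (q i j * q j i) * q j j = -1 := by
        rcases mul_eq_zero.1 (show (q i i * (q i j * q j i) * q j j - 1) *
          (q i i * (q i j * q j i) * q j j + 1) = 0 by linear_combination hsq) with h | h
        · exact absurd (sub_eq_zero.1 h) h1
        · linear_combination h
      rcases mul_eq_zero.1 hserre with h9 | h9
      · exact h7 (by linear_combination h8 - (q i j * q j i * q j j) * h9)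
      · exact h6 (by linear_combination h8 + q j j * h9)
  · have := le_letterDim hij hq h2 _ fun m => rfl
    simpa [Finset.prod_range_succ] using this

omit hall in
/-- Converse of `rootVec_two_mul_rootVec_one`: applying `(∂_j)² ∂_i` determines the scalar, and
applying `∂_j ∂_i` then gives the identity of the matrix entries. -/
lemma identity_of_mul_eq_smul_mul {κ : k}
    (h2 : rootVec q i j 2 ≠ 0)
    (h : rootVec q i j 1 * rootVec q i j 2 = κ • (rootVec q i j 2 * rootVec q i j 1)) :
    1 + (1 - q i j * q j i * q j j) * (q i i * (q i j * q j i) * q j j * (1 + q j j)) =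
      q i i ^ 2 * (q i j * q j i) ^ 3 * q j j ^ 4 := by
  have hz : rootVec q i j 1 ≠ 0 := fun h => h2 (rootVec_eq_zero_of_le h (by omega))
  have hd2 := rootScalar_ne_zero_of_le hij h2 2 le_rfl
  have hd1 := rootScalar_ne_zero_of_le hij h2 1 (by omega)
  have hlz := isLow_rootVec (q := q) hij 1
  have hlw := isLow_rootVec (q := q) hij 2
  have hE2 := congrArg (rootDeriv i j 2) h
  rw [map_smul, rootDeriv_mul hlz.tail hlw.tail (isHomog_rootVec i j 2),
    rootDeriv_mul hlw.tail hlz.tail (isHomog_rootVec i j 1), rootDeriv_rootVec hij,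
    rootDeriv_rootVec_of_lt hij (by omega : 1 < 2)] at hE2
  simp only [zero_mul, mul_zero, smul_zero, add_zero, zero_add, mul_smul_comm, smul_mul_assoc,
    mul_one, one_mul, smul_smul] at hE2
  have hκ := smul_left_injective k hz hE2
  have hκ' : κ * (q i i * q i j * (q j i * q j j) ^ 2) = 1 := by
    apply mul_right_cancel₀ hd2; linear_combination -hκ
  have hE1w : rootDeriv i j 1 (rootVec q i j 2) =
      ((1 - q i j * q j i) * (1 - q i j * q j i * q j j) * (1 + q j j)) • letter q j := by
    have := tailDeriv_letter_pow (q := q) j 2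
    rw [rootDeriv, LinearMap.comp_apply, tailDeriv_rootVec_two hij, pow_one, map_smul, ← pow_two,
      this, smul_smul]
    simp [Finset.sum_range_succ]
  have hE1 := congrArg (rootDeriv i j 1) h
  rw [map_smul, rootDeriv_mul hlz.tail hlw.tail (isHomog_rootVec i j 2),
    rootDeriv_mul hlw.tail hlz.tail (isHomog_rootVec i j 1), rootDeriv_rootVec hij, hE1w] at hE1
  have hs1 : rootScalar q i j 1 = 1 - q i j * q j i := by simp [rootScalar, qFactorial]
  simp only [mul_smul_comm, smul_mul_assoc, mul_one, one_mul, letter_mul_rootVec i j 1, hs1] at hE1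
  rw [hs1] at hd1
  have hw : ((1 - q i j * q j i) * (q i i * q i j ^ 2 * (q j i * q j j ^ 2)) -
      κ * ((1 - q i j * q j i) + q i i * q i j * (q j i * q j j) *
        ((1 - q i j * q j i) * (1 - q i j * q j i * q j j) * (1 + q j j)))) •
      rootVec q i j 2 = 0 := by
    rw [← sub_eq_zero] at hE1
    rw [← hE1]
    match_scalars
    · ring
    · linear_combination ((1 - q i j * q j i) * (1 - q i j * q j i * q j j) * (1 + q j j)) * hκ'
  have hw' := (smul_eq_zero.1 hw).resolve_right h2
  apply mul_left_cancel₀ hd1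
  linear_combination -(q i i * q i j * (q j i * q j j) ^ 2) * hw' - (1 - q i j * q j i) *
    (1 + q i i * q i j * (q j i * q j j) * ((1 - q i j * q j i * q j j) * (1 + q j j))) * hκ'

end

omit [DecidableEq ι] in
/-- A homogeneous element in the span of linearly independent homogeneous elements is in the span
of those of the same degree. -/
lemma mem_span_of_isHomog [CharZero k] {i j : ι} (hij : i ≠ j) {κ : Type} {v : κ → QShuffle q}
    (hv : LinearIndependent k v) {a b : κ → ℕ} (hab : ∀ x, IsHomog i j (v x) (a x) (b x))
    {u : QShuffle q} {a₀ b₀ : ℕ} (hu : IsHomog i j u a₀ b₀)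
    (hspan : u ∈ Submodule.span k (Set.range v)) :
    u ∈ Submodule.span k (v '' {x | a x = a₀ ∧ b x = b₀}) := by
  classical
  obtain ⟨l, rfl⟩ := (Finsupp.mem_span_range_iff_exists_finsupp).1 hspan
  have key : ∀ χ : ι → k, ∀ x ∈ l.support, χ i ^ a x * χ j ^ b x = χ i ^ a₀ * χ j ^ b₀ := by
    intro χ x hx
    have h1 := hu χ
    rw [Finsupp.sum, map_sum, Finset.smul_sum, ← sub_eq_zero, ← Finset.sum_sub_distrib] at h1
    have h2 := linearIndependent_iff'.1 hv l.support
      (fun x => l x * (χ i ^ a x * χ j ^ b x - χ i ^ a₀ * χ j ^ b₀)) (by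
        rw [← h1]
        refine Finset.sum_congr rfl fun y _ => ?_
        rw [map_smul, hab y χ]
        module) x hx
    exact sub_eq_zero.1 ((mul_eq_zero.1 h2).resolve_left (Finsupp.mem_support_iff.1 hx))
  refine Submodule.sum_mem _ fun x hx => Submodule.smul_mem _ _ (Submodule.subset_span ⟨x, ?_, rfl⟩)
  have h1 := key (fun c => if c = i then 2 else 1) x hx
  have h2 := key (fun c => if c = j then 2 else 1) x hx
  simp only [if_true, if_neg hij, if_neg hij.symm, one_pow, one_mul, mul_one] at h1 h2
  exact ⟨Nat.pow_right_injective le_rfl (by exact_mod_cast h1),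
    Nat.pow_right_injective le_rfl (by exact_mod_cast h2)⟩

/-- If the letter `x_i` has square zero and the dimension is the finite product of the orders,
then the two middle root vectors commute up to a scalar: otherwise their product would be a
further independent element. -/
theorem exists_mul_eq_smul_mul [CharZero k] {i j : ι} (hij : i ≠ j) (hq : ∀ a b, q a b ≠ 0)
    (hN : rootOrder (q i i) = 2) (h2 : rootVec q i j 2 ≠ 0) (hfin : letterDim q ≠ ⊤)
    (hdim : letterDim q = rootOrder (q j j) *
      (rootOrder (q i i) * rootOrder (q i i * (q i j * q j i) * q j j) *
        rootOrder (q i i * (q i j * q j i) ^ 2 * q j j ^ 4))) :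
    ∃ κ : k, rootVec q i j 1 * rootVec q i j 2 = κ • (rootVec q i j 2 * rootVec q i j 1) := by
  obtain ⟨κ, e, d, hcard, he, -, hli⟩ := exists_linearIndependent_monomial hij hq 2
    (rootScalar_ne_zero_of_le hij h2) _ fun m => rfl
  have hspan := le_span_of_toENat_rank_eq hli (S := Subalgebra.toSubmodule (letterAlgebra q))
    (fun x => (letterAlgebra q).mul_mem (rootMonomial_mem i j _ _) (pow_mem (letter_mem j) _))
    hfin (by
      rw [hcard]; change _ = letterDim q
      rw [hdim]; simp [Finset.prod_range_succ])
  have hu := mem_span_of_isHomog hij hli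
    (a := fun x => e x 2 + (e x 1 + e x 0)) (b := fun x => e x 2 * 2 + e x 1 + d x)
    (fun x => by
      have := ((((isHomog_rootVec (q := q) i j 2).pow (e x 2)).mul
        (((isHomog_rootVec i j 1).pow (e x 1)).mul (((isHomog_rootVec i j 0).pow (e x 0)).mul
          (IsHomog.one i j)))).mul ((isHomog_letter i j).pow (d x)))
      simpa [rootMonomial] using this)
    ((isHomog_rootVec (q := q) i j 1).mul (isHomog_rootVec i j 2))
    (hspan ((letterAlgebra q).mul_mem (rootVec_mem i j 1) (rootVec_mem i j 2)))
  -- the monomials of degree `2 α_i + 3 α_j` in which `x_i` occurs at most once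
  have hsub : (fun x => rootMonomial q i j (e x) (2 + 1) * letter q j ^ d x) ''
      {x | e x 2 + (e x 1 + e x 0) = 1 + 1 ∧ e x 2 * 2 + e x 1 + d x = 1 + 2} ⊆
      {rootVec q i j 2 * rootVec q i j 1, rootVec q i j 2 * letter q i * letter q j,
        rootVec q i j 1 * rootVec q i j 1 * letter q j,
        rootVec q i j 1 * letter q i * letter q j ^ 2} := by
    rintro _ ⟨x, ⟨h1, h3⟩, rfl⟩
    have h0 : e x 0 < 2 := by
      have := he x 0 (by omega)
      simp only [pow_zero, mul_one, ne_eq, OfNat.ofNat_ne_zero, not_false_eq_true, zero_pow, hN]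
        at this
      exact_mod_cast this
    simp only [rootMonomial, rootVec_zero, mul_one, Set.mem_insert_iff, Set.mem_singleton_iff]
    generalize e x 0 = e0 at *
    generalize e x 1 = e1 at *
    generalize e x 2 = e2 at *
    generalize d x = d0 at *
    obtain ⟨rfl, rfl, rfl, rfl⟩ | ⟨rfl, rfl, rfl, rfl⟩ | ⟨rfl, rfl, rfl, rfl⟩ |
      ⟨rfl, rfl, rfl, rfl⟩ : (e2 = 1 ∧ e1 = 1 ∧ e0 = 0 ∧ d0 = 0) ∨
      (e2 = 1 ∧ e1 = 0 ∧ e0 = 1 ∧ d0 = 1) ∨ (e2 = 0 ∧ e1 = 2 ∧ e0 = 0 ∧ d0 = 1) ∨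
      (e2 = 0 ∧ e1 = 1 ∧ e0 = 1 ∧ d0 = 2) := by omega
    · left; simp
    · right; left; simp
    · right; right; left; simp [pow_two]
    · right; right; right; simp
  replace hu := Submodule.span_mono hsub hu
  rw [Submodule.mem_span_insert] at hu
  obtain ⟨c₁, u₁, hu₁, hu⟩ := hu
  rw [Submodule.mem_span_insert] at hu₁
  obtain ⟨c₂, u₂, hu₂, rfl⟩ := hu₁
  rw [Submodule.mem_span_pair] at hu₂
  obtain ⟨c₃, c₄, rfl⟩ := hu₂
  refine ⟨c₁, ?_⟩
  have hz := tailDeriv_rootVec_of_ne (q := q) hij.symm j 1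
  have hw := tailDeriv_rootVec_of_ne (q := q) hij.symm j 2
  have hx := tailDeriv_letter_of_ne (q := q) hij.symm
  have hD1 := congrArg (tailDeriv j) hu
  have hy2 := tailDeriv_letter_pow (q := q) j 2
  simp only [map_add, map_smul, tailDeriv_mul, hz, hw, hx, hy2, tailDeriv_letter_self, zero_mul,
    mul_zero, add_zero, zero_add, mul_one, smul_zero, Nat.add_one_sub_one, pow_one,
    mul_smul_comm] at hD1
  have hD2 := congrArg (tailDeriv j) hD1
  simp only [map_add, map_smul, tailDeriv_mul, hz, hw, hx, tailDeriv_letter_self, zero_mul,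
    mul_zero, add_zero, zero_add, mul_one, smul_zero, map_zero] at hD2
  -- applying `∂_j` twice isolates the last term, and once the two middle ones
  have hb : ∑ l ∈ Finset.range 2, q j j ^ l ≠ 0 := by
    have := rootScalar_ne_zero_of_le hij h2 2 le_rfl
    intro h
    have h0 : qFactorial (q j j) 2 = 0 := by
      rw [qFactorial, Finset.prod_range_succ, h, mul_zero]
    exact this (by rw [rootScalar, h0, mul_zero])
  have h4 : c₄ • (rootVec q i j 1 * letter q i) = 0 := by
    rw [smul_comm] at hD2
    exact (smul_eq_zero.1 hD2.symm).resolve_left hb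
  have h5 : c₄ • (rootVec q i j 1 * letter q i * letter q j ^ 2) = 0 := by
    rw [← smul_mul_assoc, h4, zero_mul]
  have h6 : c₂ • (rootVec q i j 2 * letter q i) +
      c₃ • (rootVec q i j 1 * rootVec q i j 1) = 0 := by
    rw [smul_comm, ← smul_mul_assoc c₄, h4, zero_mul, smul_zero, add_zero] at hD1
    exact hD1.symm
  rw [hu, h5, add_zero, ← smul_mul_assoc c₂, ← smul_mul_assoc c₃, ← add_mul, h6, zero_mul, add_zero]

end QShuffle

/-! ### Recursions for reduced words, quantum symmetrizers and shuffles -/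

namespace Nichols

/-- The permutation of `{0, …, n}` that maps `0` to `j` and is otherwise given by `y`. -/
def permCons {n : ℕ} (j : Fin (n + 1)) (y : Equiv.Perm (Fin n)) : Equiv.Perm (Fin (n + 1)) :=
  j.cycleRange⁻¹ * Equiv.Perm.decomposeFin.symm (0, y)

@[simp] lemma permCons_zero {n : ℕ} (j : Fin (n + 1)) (y : Equiv.Perm (Fin n)) :
    permCons j y 0 = j := by
  simp [permCons, Equiv.Perm.inv_def]

@[simp] lemma permCons_succ {n : ℕ} (j : Fin (n + 1)) (y : Equiv.Perm (Fin n)) (a : Fin n) :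
    permCons j y a.succ = j.succAbove (y a) := by
  simp [permCons, Equiv.Perm.inv_def]

lemma bijective_permCons (n : ℕ) : Function.Bijective
    (fun p : Fin (n + 1) × Equiv.Perm (Fin n) => permCons p.1 p.2) := by
  rw [Fintype.bijective_iff_injective_and_card]
  refine ⟨?_, by simp [Fintype.card_perm, Nat.factorial_succ]⟩
  rintro ⟨j, y⟩ ⟨j', y'⟩ h
  simp only at h
  obtain rfl : j = j' := by simpa using congrArg (fun x => x 0) h
  obtain rfl : y = y' := by
    ext1 a
    have := congrArg (fun x => x a.succ) h
    simpa using this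
  rfl

/-- Permutations of `{0, …, n}` are given by the image of `0` and a permutation of `n` letters. -/
noncomputable def permConsEquiv (n : ℕ) :
    Fin (n + 1) × Equiv.Perm (Fin n) ≃ Equiv.Perm (Fin (n + 1)) :=
  Equiv.ofBijective _ (bijective_permCons n)

lemma reducedWord_permCons {n : ℕ} (j : Fin (n + 1)) (y : Equiv.Perm (Fin n)) :
    reducedWord (n + 1) (permCons j y) =
      (List.range (j : ℕ)).reverse ++ (reducedWord n y).map Nat.succ := by
  rw [reducedWord, permCons_zero, permCons, mul_inv_cancel_left, Equiv.apply_symm_apply]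

lemma reducedWord_one (n : ℕ) : reducedWord n 1 = [] := by
  induction n with
  | zero => rfl
  | succ n ih =>
    have : (1 : Equiv.Perm (Fin (n + 1))) = permCons 0 1 := by
      ext1 a
      refine Fin.cases ?_ (fun a => ?_) a <;> simp
    rw [this, reducedWord_permCons, ih]; rfl

lemma finRotate_eq_permCons (n : ℕ) : finRotate (n + 2) = permCons 1 (finRotate (n + 1)) := by
  ext1 a
  refine Fin.cases ?_ (fun a => ?_) a
  · simp
  · refine Fin.lastCases ?_ (fun b => ?_) a
    · rw [permCons_succ, Fin.succ_last, finRotate_last, finRotate_last]; simp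
    · rw [permCons_succ, finRotate_apply, finRotate_apply, Fin.succ_castSucc,
        Fin.coeSucc_eq_succ, Fin.coeSucc_eq_succ, ← Fin.succ_zero_eq_one, Fin.succ_succAbove_succ,
        Fin.zero_succAbove]

lemma reducedWord_finRotate (n : ℕ) : reducedWord (n + 1) (finRotate (n + 1)) = List.range n := by
  induction n with
  | zero => exact reducedWord_one 1
  | succ n ih =>
    rw [finRotate_eq_permCons, reducedWord_permCons, ih, List.range_succ_eq_map]
    simp

/-- A permutation that is increasing on all indices but the last one and moves `0` is the cyclic
rotation. -/
lemma eq_finRotate_iff {n : ℕ} (x : Equiv.Perm (Fin (n + 2))) :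
    ((∀ a b : Fin (n + 2), a < b → ((b : ℕ) < n + 1 ∨ n + 1 ≤ (a : ℕ)) → x a < x b) ∧ x 0 ≠ 0) ↔
      x = finRotate (n + 2) := by
  have hrot : ∀ a : Fin (n + 1), finRotate (n + 2) a.castSucc = a.succ := fun a => by
    rw [finRotate_apply, Fin.coeSucc_eq_succ]
  constructor
  · rintro ⟨h, h0⟩
    have hmono : StrictMono (fun a : Fin (n + 1) => x a.castSucc) := fun a b hab =>
      h _ _ (by simpa using hab) (Or.inl b.2)
    have hne : ∀ a : Fin (n + 1), x a.castSucc ≠ 0 := by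
      intro a ha
      have := hmono.monotone (Fin.zero_le a)
      simp only [ha, Fin.castSucc_zero] at this
      exact h0 (le_antisymm this (Fin.zero_le _))
    have hlast : x (Fin.last (n + 1)) = 0 := by
      obtain ⟨a, ha⟩ := x.surjective 0
      induction a using Fin.lastCases with
      | last => exact ha
      | cast a => exact absurd ha (hne a)
    have hrange : Set.range (fun a : Fin (n + 1) => x a.castSucc) =
        Set.range (Fin.succ : Fin (n + 1) → Fin (n + 2)) := by
      rw [Fin.range_succ]
      ext y
      constructor
      · rintro ⟨a, rfl⟩; exact hne a
      · intro hy
        obtain ⟨a, rfl⟩ := x.surjective y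
        induction a using Fin.lastCases with
        | last => exact absurd hlast hy
        | cast a => exact ⟨a, rfl⟩
    have heq := (hmono.range_inj Fin.strictMono_succ).1 hrange
    ext1 a
    induction a using Fin.lastCases with
    | last => rw [hlast, finRotate_last]
    | cast a => rw [hrot]; exact congrFun heq a
  · rintro rfl
    refine ⟨fun a b hab h => ?_, by simp⟩
    induction b using Fin.lastCases with
    | last =>
      have : (a : ℕ) < n + 1 := hab
      rcases h with h | h
      · simp at h
      · omega
    | cast b =>
      obtain ⟨a, rfl⟩ : ∃ a' : Fin (n + 1), a = a'.castSucc :=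
        ⟨⟨a, lt_trans hab b.2⟩, rfl⟩
      rw [hrot, hrot]
      simpa using hab

universe u v

variable {k : Type u} [Field k] {V : Type v} [AddCommGroup V] [Module k V]

lemma shiftEnd_mul {n : ℕ} (f g : Module.End k (⨂[k]^n V)) :
    shiftEnd (f * g) = shiftEnd f * shiftEnd g := by
  rw [shiftEnd, Module.End.mul_eq_comp, LinearMap.lTensor_comp, LinearEquiv.conj_comp]; rfl

lemma shiftEnd_one {n : ℕ} : shiftEnd (1 : Module.End k (⨂[k]^n V)) = 1 := by
  rw [shiftEnd, Module.End.one_eq_id, LinearMap.lTensor_id, LinearEquiv.conj_id]; rfl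

lemma shiftEnd_zero {n : ℕ} : shiftEnd (0 : Module.End k (⨂[k]^n V)) = 0 := by
  rw [shiftEnd, LinearMap.lTensor_zero, map_zero]

lemma shiftEnd_add {n : ℕ} (f g : Module.End k (⨂[k]^n V)) :
    shiftEnd (f + g) = shiftEnd f + shiftEnd g := by
  rw [shiftEnd, LinearMap.lTensor_add, map_add]; rfl

lemma shiftEnd_sum {n : ℕ} {κ : Type*} (s : Finset κ) (f : κ → Module.End k (⨂[k]^n V)) :
    shiftEnd (∑ x ∈ s, f x) = ∑ x ∈ s, shiftEnd (f x) := by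
  classical
  induction s using Finset.induction_on with
  | empty => simp [shiftEnd_zero]
  | insert a s ha ih => rw [Finset.sum_insert ha, Finset.sum_insert ha, shiftEnd_add, ih]

lemma shiftEnd_cons {n : ℕ} (f : Module.End k (⨂[k]^n V)) (x : V) (u : ⨂[k]^n V) :
    shiftEnd f (cons k V n (x ⊗ₜ u)) = cons k V n (x ⊗ₜ f u) := by
  simp [shiftEnd, LinearEquiv.conj_apply]

variable (c : V ⊗[k] V →ₗ[k] V ⊗[k] V)

lemma braidGen_succ (n i : ℕ) : braidGen c (n + 1) (i + 1) = shiftEnd (braidGen c n i) := by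
  rw [braidGen]

lemma prod_map_succ (n : ℕ) (l : List ℕ) : ((l.map Nat.succ).map (braidGen c (n + 1))).prod =
    shiftEnd ((l.map (braidGen c n)).prod) := by
  induction l with
  | nil => simp [shiftEnd_one]
  | cons i l ih => simp only [List.map_cons, List.prod_cons, ih, shiftEnd_mul, braidGen_succ]

/-- The operator `∑_j σ_{j-1} ⋯ σ_0` on `V^{⊗(n+1)}`, which moves the first tensor factor to all
positions. -/
noncomputable def insertFirst (n : ℕ) : Module.End k (⨂[k]^(n + 1) V) :=
  ∑ j : Fin (n + 1), ((List.range (j : ℕ)).reverse.map (braidGen c (n + 1))).prod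

/-- The operator `σ_0 ⋯ σ_{n-1}` on `V^{⊗(n+1)}`, which moves the last tensor factor to the
front. -/
noncomputable def braidBack (n : ℕ) : Module.End k (⨂[k]^(n + 1) V) :=
  ((List.range n).map (braidGen c (n + 1))).prod

lemma permLift_permCons {n : ℕ} (j : Fin (n + 1)) (y : Equiv.Perm (Fin n)) :
    permLift c (n + 1) (permCons j y) =
      ((List.range (j : ℕ)).reverse.map (braidGen c (n + 1))).prod * shiftEnd (permLift c n y) := by
  rw [permLift, reducedWord_permCons, List.map_append, List.prod_append, prod_map_succ, permLift]

lemma quantumSymmetrizer_succ (n : ℕ) : quantumSymmetrizer c (n + 1) =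
    insertFirst c n * shiftEnd (quantumSymmetrizer c n) := by
  rw [quantumSymmetrizer, ← (permConsEquiv n).sum_comp, Fintype.sum_prod_type, quantumSymmetrizer,
    shiftEnd_sum, insertFirst, Finset.sum_mul]
  refine Finset.sum_congr rfl fun j _ => ?_
  rw [Finset.mul_sum]
  exact Finset.sum_congr rfl fun y _ => permLift_permCons c j y

/-- A permutation increasing on all indices but the first one is determined by the image of `0`. -/
lemma shuffleMul_one (n : ℕ) : shuffleMul c (n + 1) 1 = insertFirst c n := by
  classical
  have hiff : ∀ j (y : Equiv.Perm (Fin n)), (∀ a b : Fin (n + 1), a < b →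
      ((b : ℕ) < 1 ∨ 1 ≤ (a : ℕ)) → permCons j y a < permCons j y b) ↔ y = 1 := by
    intro j y
    constructor
    · intro h
      have hmono : StrictMono y := fun a b hab => by
        have := h a.succ b.succ (by simpa using hab) (Or.inr (by simp))
        simpa using this
      have := (hmono.range_inj strictMono_id).1
        (by rw [y.surjective.range_eq, Set.range_id])
      ext1 a
      exact congrFun this a
    · rintro rfl a b hab h
      induction b using Fin.cases with
      | zero => exact absurd hab (Fin.not_lt_zero a)
      | succ b =>
        induction a using Fin.cases with
        | zero => simp at h
        | succ a => simpa using hab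
  rw [shuffleMul, Finset.sum_filter, ← (permConsEquiv n).sum_comp, Fintype.sum_prod_type,
    insertFirst]
  refine Finset.sum_congr rfl fun j _ => ?_
  rw [Fintype.sum_eq_single 1]
  · refine (if_pos ((hiff j 1).2 rfl)).trans ?_
    change permLift c (n + 1) (permCons j 1) = _
    rw [permLift_permCons, permLift, reducedWord_one]
    simp [shiftEnd_one]
  · intro y hy
    exact if_neg fun h => hy ((hiff j y).1 h)

lemma insertFirst_zero : insertFirst c 0 = 1 := by simp [insertFirst]

lemma insertFirst_succ (n : ℕ) : insertFirst c (n + 1) =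
    1 + shiftEnd (insertFirst c n) * braidGen c (n + 2) 0 := by
  rw [insertFirst, Fin.sum_univ_succ, insertFirst, shiftEnd_sum, Finset.sum_mul]
  congr 1
  refine Finset.sum_congr rfl fun j _ => ?_
  rw [Fin.val_succ, List.range_succ_eq_map, List.reverse_cons, List.map_append, List.prod_append,
    ← List.map_reverse, prod_map_succ]
  simp

lemma shuffleMul_one_zero : shuffleMul c 1 0 = 1 := by
  classical
  rw [shuffleMul, Finset.sum_filter, Fintype.sum_eq_single 1]
  · rw [if_pos (fun a b hab => absurd hab (by omega)), permLift, reducedWord_one]; rfl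
  · intro y hy; exact absurd (Subsingleton.elim y 1) hy

/-- A permutation increasing on all indices but the last one either fixes `0`, and is then given by
such a permutation of the remaining indices, or is the cyclic rotation. -/
lemma shuffleMul_succ (n : ℕ) : shuffleMul c (n + 2) (n + 1) =
    shiftEnd (shuffleMul c (n + 1) n) + braidBack c (n + 1) := by
  classical
  have hsplit : ∀ x : Equiv.Perm (Fin (n + 2)),
      (if ∀ a b : Fin (n + 2), a < b → ((b : ℕ) < n + 1 ∨ n + 1 ≤ (a : ℕ)) → x a < x b then
        permLift c (n + 2) x else 0) =
      (if (∀ a b : Fin (n + 2), a < b → ((b : ℕ) < n + 1 ∨ n + 1 ≤ (a : ℕ)) → x a < x b) ∧ x 0 = 0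
        then permLift c (n + 2) x else 0) +
      (if x = finRotate (n + 2) then permLift c (n + 2) x else 0) := by
    intro x
    have := eq_finRotate_iff x
    by_cases h : ∀ a b : Fin (n + 2), a < b → ((b : ℕ) < n + 1 ∨ n + 1 ≤ (a : ℕ)) → x a < x b
    · by_cases h0 : x 0 = 0
      · rw [if_pos h, if_pos ⟨h, h0⟩, if_neg (fun hx => (this.2 hx).2 h0), add_zero]
      · rw [if_pos h, if_neg (fun hx => h0 hx.2), if_pos (this.1 ⟨h, h0⟩), zero_add]
    · rw [if_neg h, if_neg (fun hx => h hx.1), if_neg (fun hx => h (this.2 hx).1), add_zero]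
  have hiff : ∀ j (y : Equiv.Perm (Fin (n + 1))), ((∀ a b : Fin (n + 2), a < b →
      ((b : ℕ) < n + 1 ∨ n + 1 ≤ (a : ℕ)) → permCons j y a < permCons j y b) ∧
        permCons j y 0 = 0) ↔
      ((∀ a b : Fin (n + 1), a < b → ((b : ℕ) < n ∨ n ≤ (a : ℕ)) → y a < y b) ∧ j = 0) := by
    intro j y
    rw [permCons_zero]
    refine and_congr_left ?_
    rintro rfl
    constructor
    · intro h a b hab hh
      have := h a.succ b.succ (by simpa using hab) (by simpa using hh)
      simpa using this
    · intro h a b hab hh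
      induction b using Fin.cases with
      | zero => exact absurd hab (Fin.not_lt_zero a)
      | succ b =>
        induction a using Fin.cases with
        | zero => simp
        | succ a =>
          simpa using h a b (by simpa using hab) (by simpa using hh)
  rw [shuffleMul, Finset.sum_filter, Finset.sum_congr rfl fun x _ => hsplit x,
    Finset.sum_add_distrib]
  congr 1
  · rw [← (permConsEquiv (n + 1)).sum_comp, Fintype.sum_prod_type, Fintype.sum_eq_single 0]
    · rw [shuffleMul, Finset.sum_filter, shiftEnd_sum]
      refine Finset.sum_congr rfl fun y _ => ?_
      change (if _ ∧ permCons 0 y 0 = 0 then permLift c (n + 2) (permCons 0 y) else 0) = _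
      rw [apply_ite shiftEnd, shiftEnd_zero, permLift_permCons]
      simp only [permConsEquiv, Equiv.ofBijective_apply, hiff, and_true]
      simp
    · intro j hj
      refine Finset.sum_eq_zero fun y _ => if_neg ?_
      simp only [permConsEquiv, Equiv.ofBijective_apply, hiff]
      exact fun h => hj h.2
  · rw [Finset.sum_ite_eq' Finset.univ, if_pos (Finset.mem_univ _), permLift, reducedWord_finRotate,
      braidBack]

lemma braidBack_succ (n : ℕ) : braidBack c (n + 1) =
    braidGen c (n + 2) 0 * shiftEnd (braidBack c n) := by
  rw [braidBack, List.range_succ_eq_map, List.map_cons, List.prod_cons, prod_map_succ, braidBack]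

lemma braidPast_succ (n : ℕ) : braidPast c (n + 1) =
    shiftEnd (braidPast c n) * braidGen c (n + 2) 0 := by
  rw [braidPast, List.range_succ_eq_map, List.reverse_cons, List.map_append, List.prod_append,
    ← List.map_reverse, prod_map_succ, braidPast]
  simp

end Nichols

/-! ### The Nichols algebra inside the quantum shuffle algebra -/

namespace QShuffle

variable {ι k : Type*} [Field k] {q : ι → ι → k} [DecidableEq ι]

/-- Putting the letter `a` in front of all words. -/
def prepend (a : ι) : QShuffle q →ₗ[k] QShuffle q where
  toFun f w := match w with
    | [] => 0
    | b :: w => if b = a then f w else 0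
  map_add' f g := by
    funext w
    rcases w with _ | ⟨b, w⟩
    · exact (add_zero 0).symm
    · change (if b = a then f w + g w else 0) =
        (if b = a then f w else 0) + if b = a then g w else 0
      split_ifs <;> simp
  map_smul' c f := by
    funext w
    rcases w with _ | ⟨b, w⟩
    · exact (mul_zero c).symm
    · change (if b = a then c * f w else 0) = c * if b = a then f w else 0
      split_ifs <;> simp

@[simp] lemma prepend_nil (a : ι) (f : QShuffle q) : prepend a f [] = 0 := rfl

lemma headDeriv_prepend (a b : ι) (f : QShuffle q) :
    headDeriv b (prepend a f) = if b = a then f else 0 := by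
  ext w
  change (if b = a then f w else 0) = _
  split_ifs <;> rfl

lemma prepend_one (a : ι) : prepend a (1 : QShuffle q) = letter q a :=
  ext_head (by simp) fun b => by rw [headDeriv_prepend, headDeriv_letter]

lemma scale_prepend (χ : ι → k) (a : ι) (f : QShuffle q) :
    scale χ (prepend a f) = χ a • prepend a (scale χ f) :=
  ext_head (by simp [scale_apply]) fun b => by
    rw [headDeriv_scale, headDeriv_prepend, map_smul, headDeriv_prepend]
    split_ifs with h
    · rw [h]
    · simp

lemma letter_mul_prepend (a b : ι) (f : QShuffle q) : letter q a * prepend b f =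
    prepend a (prepend b f) + q a b • prepend b (letter q a * f) :=
  ext_head (by simp) fun d => by
    simp only [headDeriv_mul, headDeriv_prepend, headDeriv_letter, map_add, map_smul, scale_letter]
    by_cases h1 : d = a
    · subst h1
      by_cases h2 : d = b
      · subst h2; simp
      · simp [h2]
    · by_cases h2 : d = b
      · subst h2; simp [h1]
      · simp [h1, h2]

lemma prepend_mul_letter (a b : ι) (f : QShuffle q) : prepend b f * letter q a =
    prepend b (f * letter q a) + prepend a (scale (fun d => q d a) (prepend b f)) :=
  ext_head (by simp) fun d => by
    simp only [headDeriv_mul, headDeriv_prepend, headDeriv_letter, map_add]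
    by_cases h1 : d = a
    · subst h1
      by_cases h2 : d = b
      · subst h2; simp
      · simp [h2]
    · by_cases h2 : d = b
      · subst h2; simp [h1]
      · simp [h1, h2]

end QShuffle

namespace Nichols

open QShuffle

universe u v

variable {k : Type u} [Field k] {V : Type v} [AddCommGroup V] [Module k V]

lemma cons_zero (v : V) : cons k V 0 (v ⊗ₜ PiTensorProduct.tprod k fun i => i.elim0) =
    PiTensorProduct.tprod k fun _ => v := by
  rw [cons, LinearEquiv.trans_apply, LinearEquiv.trans_apply, TensorProduct.congr_tmul,
    PiTensorProduct.subsingletonEquiv_symm_apply', LinearEquiv.refl_apply, ← TensorPower.gMul_def,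
    TensorPower.tprod_mul_tprod, TensorPower.cast_tprod]
  congr 1
  funext i
  obtain rfl : i = (0 : Fin 1) := Subsingleton.elim (α := Fin 1) _ _
  rfl

variable {ι : Type*} [DecidableEq ι] (x : Module.Basis ι k V)

omit [DecidableEq ι] in
/-- Linear maps on `V^{⊗(n+1)}` are determined by their values on `x_a ⊗ u`. -/
lemma hom_ext_cons {n : ℕ} {W : Type*} [AddCommGroup W] [Module k W]
    {f g : (⨂[k]^(n + 1) V) →ₗ[k] W}
    (h : ∀ a u, f (cons k V n (x a ⊗ₜ u)) = g (cons k V n (x a ⊗ₜ u))) : f = g := by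
  have h1 : f ∘ₗ (cons k V n).toLinearMap = g ∘ₗ (cons k V n).toLinearMap :=
    TensorProduct.ext (x.ext fun a => LinearMap.ext fun u => h a u)
  ext1
  ext m
  have := LinearMap.congr_fun h1 ((cons k V n).symm (PiTensorProduct.tprod k m))
  simpa using this

variable (q : ι → ι → k)

/-- The coordinates of the elements of `V^{⊗n}` with respect to the basis of words. -/
noncomputable def wordMap : (n : ℕ) → (⨂[k]^n V) →ₗ[k] QShuffle q
  | 0 => LinearMap.toSpanSingleton k _ 1 ∘ₗ
      (PiTensorProduct.isEmptyEquiv (R := k) (Fin 0)).toLinearMap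
  | n + 1 => TensorProduct.lift
      ((x.constr k (fun a => (prepend a : QShuffle q →ₗ[k] QShuffle q))).compl₂ (wordMap n)) ∘ₗ
        (cons k V n).symm.toLinearMap

lemma wordMap_zero (u : ⨂[k]^0 V) :
    wordMap x q 0 u = (PiTensorProduct.isEmptyEquiv (R := k) (Fin 0) u) • 1 := rfl

@[simp] lemma wordMap_cons (n : ℕ) (a : ι) (u : ⨂[k]^n V) :
    wordMap x q (n + 1) (cons k V n (x a ⊗ₜ u)) = prepend a (wordMap x q n u) := by
  simp [wordMap]

variable {q} (c : V ⊗[k] V →ₗ[k] V ⊗[k] V)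

lemma braidGen_zero_cons_cons (n : ℕ) (v w : V) (u : ⨂[k]^n V) :
    braidGen c (n + 2) 0 (cons k V (n + 1) (v ⊗ₜ cons k V n (w ⊗ₜ u))) =
      consTwo k V n (c (v ⊗ₜ w) ⊗ₜ u) := by
  rw [braidGen, LinearEquiv.conj_apply_apply]
  congr 1
  rw [show cons k V (n + 1) (v ⊗ₜ cons k V n (w ⊗ₜ u)) = consTwo k V n ((v ⊗ₜ w) ⊗ₜ u) from rfl,
    LinearEquiv.symm_apply_apply, LinearMap.rTensor_tmul]

variable {c} (hq : ∀ i j, c (x i ⊗ₜ[k] x j) = q i j • (x j ⊗ₜ[k] x i))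

include hq

omit [DecidableEq ι] in
lemma braidGen_zero_basis (n : ℕ) (a b : ι) (u : ⨂[k]^n V) :
    braidGen c (n + 2) 0 (cons k V (n + 1) (x a ⊗ₜ cons k V n (x b ⊗ₜ u))) =
      q a b • cons k V (n + 1) (x b ⊗ₜ cons k V n (x a ⊗ₜ u)) := by
  rw [braidGen_zero_cons_cons, hq, ← TensorProduct.smul_tmul', map_smul]; rfl

/-- Moving the first factor to all positions is left multiplication in the quantum shuffle
algebra. -/
lemma wordMap_insertFirst (n : ℕ) (a : ι) (u : ⨂[k]^n V) :
    wordMap x q (n + 1) (insertFirst c n (cons k V n (x a ⊗ₜ u))) =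
      letter q a * wordMap x q n u := by
  induction n with
  | zero =>
    rw [insertFirst_zero, Module.End.one_apply, wordMap_cons, wordMap_zero, map_smul, prepend_one,
      mul_smul_comm, mul_one]
  | succ n ih =>
    suffices H : wordMap x q (n + 2) ∘ₗ insertFirst c (n + 1) ∘ₗ (cons k V (n + 1)).toLinearMap ∘ₗ
        TensorProduct.mk k V _ (x a) = LinearMap.mulLeft k (letter q a) ∘ₗ wordMap x q (n + 1) from
      LinearMap.congr_fun H u
    refine hom_ext_cons x fun b u => ?_
    simp only [LinearMap.comp_apply, TensorProduct.mk_apply, LinearEquiv.coe_coe,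
      LinearMap.mulLeft_apply, wordMap_cons, insertFirst_succ, LinearMap.add_apply,
      Module.End.one_apply, Module.End.mul_apply, braidGen_zero_basis x hq, map_add, map_smul,
      shiftEnd_cons, ih, letter_mul_prepend]

omit hq in
variable (k) in
/-- The diagonal action of a character on `V^{⊗n}`. -/
noncomputable def tensorScale (χ : ι → k) : (n : ℕ) → Module.End k (⨂[k]^n V)
  | 0 => 1
  | n + 1 => (cons k V n).conj
      (TensorProduct.map (x.constr k fun b => χ b • x b) (tensorScale χ n))

omit hq [DecidableEq ι] in
lemma tensorScale_cons (χ : ι → k) (n : ℕ) (a : ι) (u : ⨂[k]^n V) :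
    tensorScale k x χ (n + 1) (cons k V n (x a ⊗ₜ u)) =
      χ a • cons k V n (x a ⊗ₜ tensorScale k x χ n u) := by
  rw [tensorScale, LinearEquiv.conj_apply_apply, LinearEquiv.symm_apply_apply,
    TensorProduct.map_tmul, Module.Basis.constr_basis, ← TensorProduct.smul_tmul', map_smul]

omit hq in
lemma wordMap_tensorScale (χ : ι → k) (n : ℕ) (u : ⨂[k]^n V) :
    wordMap x q n (tensorScale k x χ n u) = scale χ (wordMap x q n u) := by
  induction n with
  | zero => rw [tensorScale, Module.End.one_apply, wordMap_zero, map_smul, map_one]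
  | succ n ih =>
    suffices H : wordMap x q (n + 1) ∘ₗ tensorScale k x χ (n + 1) =
        (scale χ).toLinearMap ∘ₗ wordMap x q (n + 1) from LinearMap.congr_fun H u
    refine hom_ext_cons x fun b u => ?_
    simp only [LinearMap.comp_apply, tensorScale_cons, map_smul, wordMap_cons, ih,
      AlgHom.toLinearMap_apply, scale_prepend]

omit [DecidableEq ι] in
/-- Moving the first factor to the end and back to the front only multiplies words by scalars. -/
lemma braidBack_braidPast (n : ℕ) (a : ι) (u : ⨂[k]^n V) :
    braidBack c n (braidPast c n (cons k V n (x a ⊗ₜ u))) =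
      cons k V n (x a ⊗ₜ tensorScale k x (fun b => q a b * q b a) n u) := by
  induction n with
  | zero => simp [braidBack, braidPast, tensorScale]
  | succ n ih =>
    suffices H : braidBack c (n + 1) ∘ₗ braidPast c (n + 1) ∘ₗ (cons k V (n + 1)).toLinearMap ∘ₗ
        TensorProduct.mk k V _ (x a) = (cons k V (n + 1)).toLinearMap ∘ₗ
        TensorProduct.mk k V _ (x a) ∘ₗ tensorScale k x (fun b => q a b * q b a) (n + 1) from
      LinearMap.congr_fun H u
    refine hom_ext_cons x fun b u => ?_
    simp only [LinearMap.comp_apply, TensorProduct.mk_apply, LinearEquiv.coe_coe,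
      braidBack_succ, braidPast_succ, Module.End.mul_apply, braidGen_zero_basis x hq, map_smul,
      shiftEnd_cons, ih, tensorScale_cons, smul_smul]

/-- Moving the first factor to the end by the braiding and then to all positions is right
multiplication in the quantum shuffle algebra, up to the diagonal action. -/
lemma wordMap_shuffleMul_braidPast (n : ℕ) (a : ι) (u : ⨂[k]^n V) :
    wordMap x q (n + 1) (shuffleMul c (n + 1) n (braidPast c n (cons k V n (x a ⊗ₜ u)))) =
      scale (q a) (wordMap x q n u) * letter q a := by
  induction n with
  | zero =>
    rw [shuffleMul_one_zero, Module.End.one_apply]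
    simp [braidPast, wordMap_zero, prepend_one]
  | succ n ih =>
    suffices H : wordMap x q (n + 2) ∘ₗ shuffleMul c (n + 2) (n + 1) ∘ₗ braidPast c (n + 1) ∘ₗ
        (cons k V (n + 1)).toLinearMap ∘ₗ TensorProduct.mk k V _ (x a) =
        LinearMap.mulRight k (letter q a) ∘ₗ (scale (q a)).toLinearMap ∘ₗ wordMap x q (n + 1) from
      LinearMap.congr_fun H u
    refine hom_ext_cons x fun b u => ?_
    simp only [LinearMap.comp_apply, TensorProduct.mk_apply, LinearEquiv.coe_coe,
      LinearMap.mulRight_apply, AlgHom.toLinearMap_apply, wordMap_cons, scale_prepend,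
      smul_mul_assoc, prepend_mul_letter]
    rw [shuffleMul_succ, LinearMap.add_apply, map_add, braidBack_braidPast x hq, tensorScale_cons,
      braidPast_succ, Module.End.mul_apply, braidGen_zero_basis x hq, map_smul, shiftEnd_cons,
      map_smul, shiftEnd_cons, map_smul, wordMap_cons, ih, wordMap_cons, map_smul, wordMap_cons,
      wordMap_tensorScale]
    have hs : ∀ f : QShuffle q, scale (fun b => q a b * q b a) f =
        scale (fun d => q d a) (scale (q a) f) := fun f => by
      ext w; simp only [scale_apply, List.prod_map_mul]; ring
    rw [hs, map_smul, smul_add, map_smul, smul_smul]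

omit hq

variable (q) in
/-- The coordinates with respect to the basis of words, in all degrees. -/
noncomputable def wordMapTotal : (⨁ n : ℕ, ⨂[k]^n V) →ₗ[k] QShuffle q :=
  DirectSum.toModule k ℕ _ (wordMap x q)

@[simp] lemma wordMapTotal_lof (n : ℕ) (u : ⨂[k]^n V) :
    wordMapTotal x q (DirectSum.lof k ℕ (fun n => ⨂[k]^n V) n u) = wordMap x q n u :=
  DirectSum.toModule_lof _ _ _

include hq in
/-- The coordinates intertwine the braided adjoint actions. -/
lemma wordMapTotal_Ad (a : ι) (v : ⨁ n : ℕ, ⨂[k]^n V) :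
    wordMapTotal x q (Ad c (x a) v) = ad a (wordMapTotal x q v) := by
  suffices H : wordMapTotal x q ∘ₗ Ad c (x a) = ad a ∘ₗ wordMapTotal x q from
    LinearMap.congr_fun H v
  refine DirectSum.linearMap_ext _ fun n => LinearMap.ext fun u => ?_
  simp only [LinearMap.comp_apply, wordMapTotal_lof, Ad, DirectSum.toModule_lof,
    LinearMap.sub_apply, TensorProduct.mk_apply, LinearEquiv.coe_coe, map_sub, Module.End.mul_apply,
    shuffleMul_one, wordMap_insertFirst x hq, wordMap_shuffleMul_braidPast x hq, ad_apply]

lemma wordMapTotal_deg1 (a : ι) : wordMapTotal x q (deg1 k (x a)) = letter q a := by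
  rw [deg1, wordMapTotal_lof, ← cons_zero, wordMap_cons, wordMap_zero]
  simp [prepend_one]

include hq in
lemma wordMapTotal_Ad_pow (i j : ι) (n : ℕ) :
    wordMapTotal x q ((Ad c (x j) ^ n) (deg1 k (x i))) = rootVec q i j n := by
  induction n with
  | zero => simpa using wordMapTotal_deg1 x i
  | succ n ih =>
    rw [pow_succ', Module.End.mul_apply, wordMapTotal_Ad x hq, ih, rootVec_succ, ad_apply]

section Injective

/-- The `b`-component of the first tensor factor. -/
noncomputable def stripFirst (n : ℕ) (b : ι) : (⨂[k]^(n + 1) V) →ₗ[k] ⨂[k]^n V :=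
  (TensorProduct.lid k _).toLinearMap ∘ₗ (x.coord b).rTensor _ ∘ₗ (cons k V n).symm.toLinearMap

lemma stripFirst_cons (n : ℕ) (a b : ι) (u : ⨂[k]^n V) :
    stripFirst x n b (cons k V n (x a ⊗ₜ u)) = if b = a then u else 0 := by
  simp [stripFirst, Finsupp.single_apply, eq_comm]

lemma headDeriv_wordMap (n : ℕ) (b : ι) (u : ⨂[k]^(n + 1) V) :
    headDeriv b (wordMap x q (n + 1) u) = wordMap x q n (stripFirst x n b u) := by
  suffices H : headDeriv b ∘ₗ wordMap x q (n + 1) = wordMap x q n ∘ₗ stripFirst x n b from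
    LinearMap.congr_fun H u
  refine hom_ext_cons x fun a u => ?_
  simp only [LinearMap.comp_apply, wordMap_cons, headDeriv_prepend, stripFirst_cons]
  split_ifs <;> simp

lemma wordMap_apply_of_length_ne (n : ℕ) (u : ⨂[k]^n V) (w : List ι) (hw : w.length ≠ n) :
    wordMap x q n u w = 0 := by
  induction n generalizing w with
  | zero =>
    rcases w with _ | ⟨b, w⟩
    · simp at hw
    · rw [wordMap_zero, QShuffle.smul_apply]; exact mul_zero _
  | succ n ih =>
    rcases w with _ | ⟨b, w⟩
    · have H : (LinearMap.proj (R := k) (φ := fun _ : List ι => k) []) ∘ₗ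
          (show (⨂[k]^(n + 1) V) →ₗ[k] (List ι → k) from wordMap x q (n + 1)) = 0 := by
        refine hom_ext_cons x fun a u => ?_
        exact congrFun (wordMap_cons x q n a u) []
      exact LinearMap.congr_fun H u
    · change headDeriv b (wordMap x q (n + 1) u) w = 0
      rw [headDeriv_wordMap]
      exact ih _ w (by simpa using hw)

lemma wordMap_injective [Fintype ι] (n : ℕ) : Function.Injective (wordMap x q n) := by
  rw [injective_iff_map_eq_zero]
  induction n with
  | zero =>
    intro u hu
    have := congrFun hu []
    rw [wordMap_zero, QShuffle.smul_apply, one_nil, mul_one] at this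
    simpa using this
  | succ n ih =>
    intro u hu
    have hsum : u = ∑ b, cons k V n (x b ⊗ₜ stripFirst x n b u) := by
      suffices H : LinearMap.id = ∑ b, (cons k V n).toLinearMap ∘ₗ TensorProduct.mk k V _ (x b) ∘ₗ
          stripFirst x n b by
        simpa using LinearMap.congr_fun H u
      refine hom_ext_cons x fun a u => ?_
      simp only [LinearMap.id_apply, LinearMap.sum_apply, LinearMap.comp_apply, stripFirst_cons]
      rw [Finset.sum_eq_single a]
      · simp
      · intro b _ hb; simp [hb]
      · simp
    rw [hsum]
    refine Finset.sum_eq_zero fun b _ => ?_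
    rw [ih (stripFirst x n b u) (by rw [← headDeriv_wordMap, hu, map_zero]),
      TensorProduct.tmul_zero, map_zero]

lemma wordMapTotal_apply (v : ⨁ n : ℕ, ⨂[k]^n V) (w : List ι) :
    wordMapTotal x q v w = wordMap x q w.length (v w.length) w := by
  induction v using DirectSum.induction_on with
  | zero => simp
  | of n u =>
    change wordMapTotal x q (DirectSum.lof k ℕ (fun n => ⨂[k]^n V) n u) w = _
    rw [wordMapTotal_lof]
    by_cases h : w.length = n
    · subst h; rw [DirectSum.of_eq_same]
    · rw [wordMap_apply_of_length_ne x n u w h, DirectSum.of_eq_of_ne _ _ _ h, map_zero,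
        QShuffle.zero_apply]
  | add v v' hv hv' =>
    rw [map_add, QShuffle.add_apply, hv, hv', DirectSum.add_apply, map_add, QShuffle.add_apply]

lemma wordMapTotal_injective [Fintype ι] : Function.Injective (wordMapTotal x q) := by
  rw [injective_iff_map_eq_zero]
  intro v hv
  ext1 n
  rw [DirectSum.zero_apply]
  refine wordMap_injective x (q := q) n ?_
  rw [map_zero]
  ext w
  by_cases h : w.length = n
  · subst h
    rw [← wordMapTotal_apply, hv]
  · exact wordMap_apply_of_length_ne x n _ w h

end Injective

lemma quantumSymmetrizer_zero : quantumSymmetrizer c 0 = 1 := by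
  rw [quantumSymmetrizer, Fintype.sum_eq_single 1 fun y hy => absurd (Subsingleton.elim y 1) hy]
  rfl

include hq in
lemma wordMap_quantumSymmetrizer_cons (n : ℕ) (a : ι) (u : ⨂[k]^n V) :
    wordMap x q (n + 1) (quantumSymmetrizer c (n + 1) (cons k V n (x a ⊗ₜ u))) =
      letter q a * wordMap x q n (quantumSymmetrizer c n u) := by
  rw [quantumSymmetrizer_succ, Module.End.mul_apply, shiftEnd_cons, wordMap_insertFirst x hq]

include hq in
lemma wordMap_quantumSymmetrizer_mem (n : ℕ) (u : ⨂[k]^n V) :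
    wordMap x q n (quantumSymmetrizer c n u) ∈ letterAlgebra q := by
  induction n with
  | zero =>
    rw [quantumSymmetrizer_zero, Module.End.one_apply, wordMap_zero]
    exact Subalgebra.smul_mem _ (one_mem _) _
  | succ n ih =>
    have H : (Subalgebra.toSubmodule (letterAlgebra q)).mkQ ∘ₗ wordMap x q (n + 1) ∘ₗ
        quantumSymmetrizer c (n + 1) = 0 := by
      refine hom_ext_cons x fun a u => ?_
      simp only [LinearMap.comp_apply, wordMap_quantumSymmetrizer_cons x hq, LinearMap.zero_apply]
      rw [Submodule.mkQ_apply, Submodule.Quotient.mk_eq_zero]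
      exact (letterAlgebra q).mul_mem (letter_mem a) (ih u)
    have := LinearMap.congr_fun H u
    rwa [LinearMap.comp_apply, LinearMap.comp_apply, LinearMap.zero_apply, Submodule.mkQ_apply,
      Submodule.Quotient.mk_eq_zero] at this

include hq in
/-- The coordinates identify the Nichols algebra with the subalgebra of the quantum shuffle algebra
generated by the letters. -/
lemma map_nicholsAlgebra :
    (nicholsAlgebra c).map (wordMapTotal x q) = Subalgebra.toSubmodule (letterAlgebra q) := by
  apply le_antisymm
  · rw [nicholsAlgebra, ← LinearMap.range_comp]
    rintro _ ⟨v, rfl⟩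
    induction v using DirectSum.induction_on with
    | zero => simp
    | of n u =>
      change wordMapTotal x q (DirectSum.lmap (quantumSymmetrizer c)
        (DirectSum.lof k ℕ (fun n => ⨂[k]^n V) n u)) ∈ _
      rw [DirectSum.lmap_lof, wordMapTotal_lof]
      exact wordMap_quantumSymmetrizer_mem x hq n u
    | add v v' hv hv' => rw [map_add]; exact Submodule.add_mem _ hv hv'
  · refine adjoin_le_of_mul_mem ?_ ?_
    · refine ⟨_, ⟨DirectSum.lof k ℕ (fun n => ⨂[k]^n V) 0
        (PiTensorProduct.tprod k fun i => i.elim0), rfl⟩, ?_⟩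
      rw [DirectSum.lmap_lof, wordMapTotal_lof, quantumSymmetrizer_zero, Module.End.one_apply,
        wordMap_zero]
      simp
    · rintro _ ⟨a, rfl⟩ _ ⟨_, ⟨v, rfl⟩, rfl⟩
      induction v using DirectSum.induction_on with
      | zero => simp
      | of n u =>
        refine ⟨_, ⟨DirectSum.lof k ℕ (fun n => ⨂[k]^n V) (n + 1) (cons k V n (x a ⊗ₜ u)), rfl⟩, ?_⟩
        change _ = letter q a * wordMapTotal x q (DirectSum.lmap (quantumSymmetrizer c)
          (DirectSum.lof k ℕ (fun n => ⨂[k]^n V) n u))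
        rw [DirectSum.lmap_lof, DirectSum.lmap_lof, wordMapTotal_lof, wordMapTotal_lof,
          wordMap_quantumSymmetrizer_cons x hq]
      | add v v' hv hv' => rw [map_add, map_add, mul_add]; exact Submodule.add_mem _ hv hv'

include hq in
theorem nicholsDim_eq_letterDim [Fintype ι] : nicholsDim c = letterDim q := by
  have h := (Submodule.equivMapOfInjective (wordMapTotal x q) (wordMapTotal_injective x)
    (nicholsAlgebra c)).lift_rank_eq
  rw [map_nicholsAlgebra x hq] at h
  have := congrArg Cardinal.toENat h
  rwa [Cardinal.toENat_lift, Cardinal.toENat_lift] at this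

include hq in
lemma hasNilpotencyOrder_iff [Fintype ι] (i j : ι) (r : ℕ) :
    HasNilpotencyOrder (Ad c (x j)) (deg1 k (x i)) (r + 1) ↔
      rootVec q i j r ≠ 0 ∧ rootVec q i j (r + 1) = 0 := by
  have hinj := wordMapTotal_injective x (q := q)
  have h : ∀ n, (Ad c (x j) ^ n) (deg1 k (x i)) = 0 ↔ rootVec q i j n = 0 := fun n => by
    rw [← wordMapTotal_Ad_pow x hq, map_eq_zero_iff _ hinj]
  constructor
  · rintro ⟨r', hr, h1, h2⟩
    obtain rfl : r = r' := by omega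
    exact ⟨fun h0 => h1 ((h r).2 h0), (h (r + 1)).1 h2⟩
  · rintro ⟨h1, h2⟩
    exact ⟨r, rfl, fun h0 => h1 ((h r).1 h0), (h (r + 1)).2 h2⟩

include hq in
omit [DecidableEq ι] in
lemma braiding_coeff_ne_zero (hc : Function.Injective c) (a b : ι) : q a b ≠ 0 := by
  intro h
  have h1 : x a ⊗ₜ[k] x b = 0 := hc (by rw [hq, h, zero_smul, map_zero])
  exact (x.tensorProduct x).ne_zero (a, b) (by simpa using h1)

end Nichols

/-! ### Dimensions of Nichols algebras of rank two -/

namespace Nichols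

variable {k : Type*} [Field k]

lemma rootOrder_ne_top {a : k} {n : ℕ} (hn : 0 < n) (h1 : a ≠ 1) (h : a ^ n = 1) :
    rootOrder a ≠ ⊤ := by
  rw [rootOrder, if_pos ⟨h1, isOfFinOrder_iff_pow_eq_one.2 ⟨n, hn, h⟩⟩]
  simp

lemma rootOrder_eq_two_iff [CharZero k] (a : k) : rootOrder a = 2 ↔ a = -1 := by
  constructor
  · intro h
    obtain ⟨h1, -, -⟩ := eq_of_rootOrder_eq (n := 2) (by exact_mod_cast h)
    have h2 : a ^ 2 = 1 := rootOrder_pow_eq_one (n := 2) (by exact_mod_cast h)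
    rcases mul_self_eq_one_iff.1 ((pow_two a).symm.trans h2) with h | h
    · exact absurd h h1
    · exact h
  · rintro rfl
    exact_mod_cast rootOrder_eq_of_orderOf (n := 2) (by omega)
      (orderOf_eq_prime (by norm_num) (by norm_num))

lemma rootOrder_eq_three_iff [CharZero k] (b : k) : rootOrder b = 3 ↔ 1 + b + b ^ 2 = 0 := by
  constructor
  · intro h
    obtain ⟨h1, -, -⟩ := eq_of_rootOrder_eq (n := 3) (by exact_mod_cast h)
    have h2 : b ^ 3 = 1 := rootOrder_pow_eq_one (n := 3) (by exact_mod_cast h)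
    apply mul_left_cancel₀ (sub_ne_zero.2 h1)
    linear_combination h2
  · intro h
    have h1 : b ≠ 1 := by rintro rfl; norm_num at h
    exact_mod_cast rootOrder_eq_of_orderOf (n := 3) (by omega)
      (orderOf_eq_prime (by linear_combination (b - 1) * h) h1)

end Nichols

open Nichols QShuffle in
theorem mainTheorem5
    {k : Type*} [Field k] [IsAlgClosed k] [CharZero k]
    {V : Type*} [AddCommGroup V] [Module k V]
    (c : TensorProduct k V V →ₗ[k] TensorProduct k V V)
    (hc : Nichols.IsBraiding c) (hfin : Nichols.IsFiniteGroupType c)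
    (x : Module.Basis (Fin 2) k V) (q : Matrix (Fin 2) (Fin 2) k)
    (hq : ∀ i j, c (x i ⊗ₜ[k] x j) = q i j • (x j ⊗ₜ[k] x i))
    (r : ℕ)
    (hr : Nichols.HasNilpotencyOrder (Nichols.Ad c (x 1)) (Nichols.deg1 k (x 0)) (r + 1))
    (N₁ N₂ : ℕ∞) (M : ℕ → ℕ∞)
    (hN₁ : N₁ = Nichols.rootOrder (q 0 0)) (hN₂ : N₂ = Nichols.rootOrder (q 1 1))
    (hM : ∀ i, M i = Nichols.rootOrder (q 0 0 * (q 0 1 * q 1 0) ^ i * q 1 1 ^ (i ^ 2))) :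
    N₁ * N₂ * ∏ i ∈ Finset.Icc 1 r, M i ≤ Nichols.nicholsDim c ∧
    (Nichols.HasNilpotencyOrder (Nichols.Ad c (x 0)) (Nichols.deg1 k (x 1)) 2 →
      (r = 1 → Nichols.nicholsDim c = N₁ * N₂ * ∏ i ∈ Finset.Icc 1 r, M i) ∧
      (r = 2 → (N₁ ≠ 2 ∨ N₂ ≠ 3) →
        Nichols.nicholsDim c = N₁ * N₂ * ∏ i ∈ Finset.Icc 1 r, M i) ∧
      (r = 2 → N₁ = 2 → N₂ = 3 →
        ((Nichols.nicholsDim c ≠ ⊤ ∧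
            Nichols.nicholsDim c = N₁ * N₂ * ∏ i ∈ Finset.Icc 1 r, M i) ↔
          (q 0 1 * q 1 0 = -1 ∨ q 0 1 * q 1 0 = q 1 1 ∨ q 0 1 * q 1 0 = -q 1 1)))) := by
  have hq0 : ∀ a b, q a b ≠ 0 := braiding_coeff_ne_zero (q := q) x hq hc.bijective.1
  have hij : (0 : Fin 2) ≠ 1 := by decide
  have hall : ∀ b : Fin 2, b = 0 ∨ b = 1 := by decide
  rw [hasNilpotencyOrder_iff (q := q) x hq] at hr
  obtain ⟨hr1, hr2⟩ := hr
  rw [nicholsDim_eq_letterDim (q := q) x hq]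
  have hM0 : M 0 = N₁ := by rw [hM, hN₁]; simp
  have hprod : N₁ * N₂ * ∏ i ∈ Finset.Icc 1 r, M i = N₂ * ∏ i ∈ Finset.range (r + 1), M i := by
    rw [Finset.prod_range_succ', hM0, ← Finset.Ico_succ_right_eq_Icc, Finset.prod_Ico_eq_prod_range]
    simp only [Order.succ_eq_add_one, Nat.add_sub_cancel, add_comm 1]
    ring
  refine ⟨hprod ▸ hN₂ ▸ le_letterDim hij hq0 hr1 M hM, fun h => ?_⟩
  rw [hasNilpotencyOrder_iff (q := q) x hq 1 0 1] at h
  have hserre := serre_of_rootVec_eq_zero hij h.1 h.2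
  have hM1 : M 1 = rootOrder (q 0 0 * (q 0 1 * q 1 0) * q 1 1) := by rw [hM]; simp
  have hM2 : M 2 = rootOrder (q 0 0 * (q 0 1 * q 1 0) ^ 2 * q 1 1 ^ 4) := hM 2
  refine ⟨?_, ?_⟩
  · rintro rfl
    rw [letterDim_eq_of_rootVec_two_eq_zero hij hall hq0 hserre hr1 hr2, ← hN₁, ← hN₂, ← hM1]
    simp only [Finset.Icc_self, Finset.prod_singleton]
    ring
  have hIcc : ∏ i ∈ Finset.Icc 1 2, M i = M 1 * M 2 := by
    rw [show Finset.Icc 1 2 = {1, 2} from rfl, Finset.prod_pair (by decide)]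
  -- the vanishing and nonvanishing of root scalars in the case `r = 2`
  have hscal : r = 2 → (1 - q 0 1 * q 1 0 * q 1 1 ^ 2) * (1 + q 1 1 + q 1 1 ^ 2) = 0 ∧
      1 + q 1 1 ≠ 0 := by
    rintro rfl
    have h4 := (rootVec_ne_zero_iff hij 2).1 hr1
    have h5 : rootScalar q 0 1 3 = 0 := by
      by_contra h; exact (rootVec_ne_zero_iff hij 3).2 h hr2
    have h6 : rootScalar q 0 1 3 = rootScalar q 0 1 2 *
        ((1 - q 0 1 * q 1 0 * q 1 1 ^ 2) * (1 + q 1 1 + q 1 1 ^ 2)) := by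
      simp only [rootScalar, qFactorial, Finset.prod_range_succ, Finset.sum_range_succ,
        Finset.prod_range_zero, Finset.sum_range_zero]
      ring
    rw [h6] at h5
    refine ⟨(mul_eq_zero.1 h5).resolve_left h4, fun h => h4 ?_⟩
    simp [rootScalar, qFactorial, Finset.prod_range_succ, Finset.sum_range_succ, h]
  have hdim : r = 2 → 1 + (1 - q 0 1 * q 1 0 * q 1 1) * (q 0 0 * (q 0 1 * q 1 0) * q 1 1 *
      (1 + q 1 1)) = q 0 0 ^ 2 * (q 0 1 * q 1 0) ^ 3 * q 1 1 ^ 4 →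
      letterDim (q : Fin 2 → Fin 2 → k) = N₁ * N₂ * ∏ i ∈ Finset.Icc 1 2, M i := by
    rintro rfl h
    rw [letterDim_eq_of_rootVec_three_eq_zero hij hall hq0 hserre hr1 hr2 h, hIcc, hM1, hM2, hN₁,
      hN₂]
    ring
  refine ⟨?_, ?_⟩
  · intro hr hN
    obtain ⟨h1, -⟩ := hscal hr
    subst hr
    refine hdim rfl ?_
    -- for `q₁₁ p = 1` the identity is `h1`; for `q₁₁ = -1` it is a multiple of `1 - p q₂₂² = 0`
    rcases hN with hN | hN
    · have ha : q 0 0 ≠ -1 := fun h => hN (hN₁ ▸ (rootOrder_eq_two_iff _).2 h)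
      have h2 := (mul_eq_zero.1 hserre).resolve_left fun h => ha (by linear_combination h)
      generalize q 0 0 = a, q 0 1 * q 1 0 = p, q 1 1 = b at *
      linear_combination h1 - ((1 - p * b) * b * (1 + b) - (a * p + 1) * p * b ^ 4) * h2
    · have hb : 1 + q 1 1 + q 1 1 ^ 2 ≠ 0 := fun h => hN (hN₂ ▸ (rootOrder_eq_three_iff _).2 h)
      have h2 := (mul_eq_zero.1 h1).resolve_right hb
      generalize q 0 0 = a, q 0 1 * q 1 0 = p, q 1 1 = b at *
      rcases mul_eq_zero.1 hserre with h3 | h3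
      · obtain rfl : a = -1 := by linear_combination h3
        linear_combination (1 - p * b + p ^ 2 * b ^ 2) * h2
      · linear_combination h1 - ((1 - p * b) * b * (1 + b) - (a * p + 1) * p * b ^ 4) * h3
  · intro hr hN1 hN2
    obtain ⟨h1, h6⟩ := hscal hr
    subst hr
    have ha : q 0 0 = -1 := (rootOrder_eq_two_iff _).1 (hN₁ ▸ hN1)
    have hb : 1 + q 1 1 + q 1 1 ^ 2 = 0 := (rootOrder_eq_three_iff _).1 (hN₂ ▸ hN2)
    constructor
    · rintro ⟨hfin, heq⟩
      obtain ⟨κ, hκ⟩ := exists_mul_eq_smul_mul hij hq0 (hN₁ ▸ hN1) hr1 hfin (by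
        rw [heq, hIcc, ← hN₁, ← hN₂, ← hM1, ← hM2]; ring)
      have hrel := identity_of_mul_eq_smul_mul hij hr1 hκ
      -- for `q₁₁ = -1` the identity reads `(1 - p q₂₂²) (1 - p q₂₂ + p² q₂₂²) = 0`
      have hp1 : 1 - q 0 1 * q 1 0 * q 1 1 ^ 2 = 0 ∨
        (q 0 1 * q 1 0 + 1) * (q 0 1 * q 1 0 + q 1 1) = 0 := by
        rw [← mul_eq_zero]
        rw [ha] at hrel
        generalize q 0 1 * q 1 0 = p, q 1 1 = b at *
        linear_combination b * hrel - (b * (1 - p * b ^ 2) * (1 - b - p * b) +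
          (b - 1) * (1 - p * b ^ 2) * (p + 1) * (p + b)) * hb
      rcases hp1 with hp | hp
      · right; left
        generalize q 0 1 * q 1 0 = p, q 1 1 = b at *
        linear_combination -b * hp - p * (b - 1) * hb
      · rcases mul_eq_zero.1 hp with hp | hp
        · left; linear_combination hp
        · right; right; linear_combination hp
    · intro hp
      have hrel : 1 + (1 - q 0 1 * q 1 0 * q 1 1) * (q 0 0 * (q 0 1 * q 1 0) * q 1 1 *
          (1 + q 1 1)) = q 0 0 ^ 2 * (q 0 1 * q 1 0) ^ 3 * q 1 1 ^ 4 := by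
        rw [ha]
        generalize q 0 1 * q 1 0 = p, q 1 1 = b at *
        rcases hp with hp | hp | hp <;> rw [hp]
        · linear_combination (1 + b ^ 2) * hb
        · linear_combination -(b - 1) * (1 - b ^ 2 + b ^ 4) * hb
        · linear_combination (1 + b ^ 3) * (1 - b + b ^ 2) * hb
      have h2 := hdim rfl hrel
      refine ⟨?_, h2⟩
      rw [h2, hIcc, hN1, hN2]
      have hb3 : q 1 1 ^ 3 = 1 := by linear_combination (q 1 1 - 1) * hb
      have hb1 : q 1 1 ≠ 1 := by intro h; rw [h] at hb; norm_num at hb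
      have hb0 : q 1 1 ≠ 0 := hq0 1 1
      have hM1' : M 1 ≠ ⊤ := by
        rw [hM1, ha]
        generalize q 0 1 * q 1 0 = p, q 1 1 = b at *
        rcases hp with hp | hp | hp <;> rw [hp]
        · exact rootOrder_ne_top (n := 3) (by omega) (by simpa using hb1) (by simpa using hb3)
        · refine rootOrder_ne_top (n := 6) (by omega) (fun h => hb0 ?_) ?_
          · linear_combination hb + h
          · linear_combination (b ^ 9 + b ^ 6 + b ^ 3 + 1) * hb3
        · refine rootOrder_ne_top (n := 3) (by omega) (fun h => hb1 ?_) ?_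
          · linear_combination hb3 - b * h
          · linear_combination (b ^ 3 + 1) * hb3
      have hM2' : M 2 ≠ ⊤ := by
        rw [hM2, ha]
        generalize q 0 1 * q 1 0 = p, q 1 1 = b at *
        have hneg : rootOrder (-1 : k) ≠ ⊤ := by rw [(rootOrder_eq_two_iff _).2 rfl]; decide
        rcases hp with hp | hp | hp <;> rw [hp]
        · refine rootOrder_ne_top (n := 6) (by omega) (fun h => h6 ?_) ?_
          · linear_combination -b * hb3 - h
          · linear_combination (b ^ 21 + b ^ 18 + b ^ 15 + b ^ 12 + b ^ 9 + b ^ 6 + b ^ 3 + 1) * hb3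
        · rwa [show -1 * b ^ 2 * b ^ 4 = -1 by linear_combination -(b ^ 3 + 1) * hb3]
        · rwa [show -1 * (-b) ^ 2 * b ^ 4 = -1 by linear_combination -(b ^ 3 + 1) * hb3]
      exact WithTop.mul_ne_top (WithTop.mul_ne_top (by decide) (by decide))
        (WithTop.mul_ne_top hM1' hM2')
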